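/- Let $(X,d,\mu)$ be a metric measure space, i.e. $(X,d)$ is a metric space and $\mu$ is a non-negative Borel measure with $0<\mu(B(x,r))<\infty$ for all $x\in X$, $r\in(0,\infty)$, where $B(x,r)=\{y\in X: d(x,y)<r\}$. **Exponents.** $\mathcal P(X)$ is the set of measurable $q:X\to(0,\infty]$ with $\operatorname{ess\,inf}_X q>0$; $\mathcal P_b(X)$ is the set of essentially bounded $q\in\mathcal P(X)$; and $\mathcal P_b^{\log}(X)$ is the set of $p\in\mathcal P_b(X)$ for which there is $C>0$ with $$\Big|\tfrac1{p(x)}-\tfrac1{p(y)}\Big|\le \frac{C}{\log(e+1/d(x,y))}\qquad\text{for all distinct } x,y\in X .$$ For exponents $f,g$ we write $f\ll g$ if $\operatorname{ess\,inf}_X(g-f)>0$, and $f\le g$ if $f(x)\le g(x)$ for all $x\in X$. **Lebesgue and mixed spaces.** For $p\in\mathcal P_b(X)$ put $\rho_{p(\cdot)}(f)=\int_X|f(x)|^{p(x)}\,d\mu(x)$ and $\|f\|_{L^{p(\cdot)}}=\inf\{\lambda>0:\rho_{p(\cdot)}(f/\lambda)\le1\}$ (with $\inf\emptyset=\infty$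 throughout); $L^{p(\cdot)}(X,\mu)$ is the space of measurable, extended real-valued $f$ with $\rho_{p(\cdot)}(f)<\infty$ (such $f$ are finite a.e.). For $q\in\mathcal P(X)$ and a sequence $g=\{g_k\}_{k\in\mathbb Z}$ of measurable functions $g_k:X\to[0,\infty]$ put $$\|g\|_{L^{p(\cdot)}(\ell^{q(\cdot)})}=\Big\|\,x\mapsto\|\{g_k(x)\}_{k\in\mathbb Z}\|_{\ell^{q(x)}}\Big\|_{L^{p(\cdot)}},$$ $$\|g\|_{\ell^{q(\cdot)}(L^{p(\cdot)})}=\inf\Big\{\lambda>0:\ \sum_{k\in\mathbb Z}\inf\Big\{\lambda_k>0:\rho_{p(\cdot)}\Big(\frac{g_k}{\lambda\,\lambda_k^{1/q(\cdot)}}\Big)\le1\Big\}\le1\Big\},$$ where $\lambda_k^{1/\infty}:=1$. **Hajłasz-type spaces.** Let $s,p\in\mathcal P_b(X)$ and $q\in\mathcal P(X)$. For a measurable, a.e. finite $u:X\to[-\infty,\infty]$ let $\mathbb D^{s(\cdot)}(u)$ be the set of all sequences $\{g_k\}_{k\in\mathbb Z}$ of measurable functions $g_k:X\to[0,\infty]$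 for which there is a $\mu$-null set $N$ such that $$|u(x)-u(y)|\le d(x,y)^{s(x)}g_k(x)+d(x,y)^{s(y)}g_k(y)$$ for all $k\in\mathbb Z$ and all $x,y\in X\setminus N$ with $2^{-k-1}\le d(x,y)<2^{-k}$. Let $M^{s(\cdot)}_{p(\cdot),q(\cdot)}(X,d,\mu)$ and $N^{s(\cdot)}_{p(\cdot),q(\cdot)}(X,d,\mu)$ be the spaces of those $u\in L^{p(\cdot)}(X,\mu)$ for which, respectively, $$\|u\|_{M^{s(\cdot)}_{p(\cdot),q(\cdot)}}:=\|u\|_{L^{p(\cdot)}}+\inf_{g\in\mathbb D^{s(\cdot)}(u)}\|g\|_{L^{p(\cdot)}(\ell^{q(\cdot)})}<\infty,\qquad \|u\|_{N^{s(\cdot)}_{p(\cdot),q(\cdot)}}:=\|u\|_{L^{p(\cdot)}}+\inf_{g\in\mathbb D^{s(\cdot)}(u)}\|g\|_{\ell^{q(\cdot)}(L^{p(\cdot)})}<\infty .$$ For two such spaces, $E\hookrightarrow F$ means that $E\subseteq F$ and that there is a finite constant $C$ with $\|u\|_F\le C\|u\|_E$ for all $u\in E$. **Theorem.** Suppose that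 * $(X,d)$ is geometrically doubling: there is $M$ such that every ball $B(x,r)$ can be covered by at most $M$ balls of radius $r/2$; * there is $\delta\in(0,\infty)$ with $\sup_{x\in X}\mu(B(x,\delta))<\infty$; * $\mu$ is lower Ahlfors $Q(\cdot)$-regular for some $Q\in\mathcal P_b^{\log}(X)$: there is $b>0$ with $\mu(B(x,r))\ge b\,r^{Q(x)}$ for all $x\in X$ and $r\in(0,1]$. Let $p,s\in\mathcal P_b^{\log}(X)$ satisfy $sp\ll Q$, and put $\gamma:=\dfrac{Qp}{Q-sp}$. Then: 1. for every $q\in\mathcal P(X)$, $\;M^{s(\cdot)}_{p(\cdot),q(\cdot)}(X,d,\mu)\hookrightarrow L^{\gamma(\cdot)}(X,\mu)$; 2. for every $q\in\mathcal P(X)$ with $q\le p$, $\;N^{s(\cdot)}_{p(\cdot),q(\cdot)}(X,d,\mu)\hookrightarrow L^{\gamma(\cdot)}(X,\mu)$; 3. for every $q\in\mathcal P(X)$ and every $t\in\mathcal P_b^{\log}(X)$ with $t\ll s$, $\;N^{s(\cdot)}_{p(\cdot),q(\cdot)}(X,d,\mu)\hookrightarrow L^{\sigma(\cdot)}(X,\mu)$,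 where $\sigma:=\dfrac{Qp}{Q-tp}$. -/

import Mathlib

open MeasureTheory Set Filter
open scoped ENNReal

namespace VarHajlasz

/-! ### Geometry of metric measure spaces -/

section Geometry

/-- `(X, d, μ)` is a metric measure space: every ball of positive (finite) radius has positive and
finite measure. -/
def IsMetricMeasureSpace {X : Type*} [MetricSpace X] [MeasurableSpace X]
    (μ : Measure X) : Prop :=
  ∀ (x : X) (r : ℝ), 0 < r → 0 < μ (Metric.ball x r) ∧ μ (Metric.ball x r) < ∞

/-- `X` is geometrically doubling: there is `M` such that every ball of radius `r` can be covered
by at most `M` balls of radius `r / 2`. -/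
def GeometricallyDoubling (X : Type*) [MetricSpace X] : Prop :=
  ∃ M : ℕ, ∀ (x : X) (r : ℝ), 0 < r →
    ∃ S : Finset X, S.card ≤ M ∧ Metric.ball x r ⊆ ⋃ y ∈ S, Metric.ball y (r / 2)

/-- `μ` is lower Ahlfors `Q(·)`-regular. -/
def LowerAhlforsRegular {X : Type*} [MetricSpace X] [MeasurableSpace X]
    (Q : X → ℝ) (μ : Measure X) : Prop :=
  ∃ b : ℝ, 0 < b ∧ ∀ (x : X) (r : ℝ), 0 < r → r ≤ 1 →
    ENNReal.ofReal (b * r ^ Q x) ≤ μ (Metric.ball x r)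

end Geometry

/-! ### Variable exponents -/

section Exponents

/-- The class `𝒫(X)` of variable exponents `q : X → (0, ∞]` with `ess inf q > 0`. -/
structure IsExponent {X : Type*} [MeasurableSpace X] (q : X → ℝ≥0∞) (μ : Measure X) : Prop where
  measurable : Measurable q
  pos : ∀ x, 0 < q x
  essInf_pos : 0 < essInf q μ

/-- Local log-Hölder continuity of a real function on `X`. (For `x = y` the inequality
is trivially true.) -/
def LogHolder {X : Type*} [MetricSpace X] (f : X → ℝ) : Prop :=
  ∃ C : ℝ, 0 < C ∧ ∀ x y : X, |f x - f y| ≤ C / Real.log (Real.exp 1 + 1 / dist x y)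

/-- The class `𝒫_b^log(X)`: essentially bounded variable exponents `p` such that `1 / p` is locally
log-Hölder continuous. On a space in which all balls have positive measure such an exponent is
finite everywhere, hence it is taken real-valued. -/
structure IsBddLogExponent {X : Type*} [MetricSpace X] [MeasurableSpace X]
    (p : X → ℝ) (μ : Measure X) : Prop where
  measurable : Measurable p
  pos : ∀ x, 0 < p x
  essInf_pos : 0 < essInf (fun x => ENNReal.ofReal (p x)) μ
  essSup_lt_top : essSup (fun x => ENNReal.ofReal (p x)) μ < ∞
  logHolder : LogHolder (fun x => 1 / p x)

/-- `f ≪ g`, that is, `ess inf (g - f) > 0`. -/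
def MuchLess {X : Type*} [MeasurableSpace X] (f g : X → ℝ) (μ : Measure X) : Prop :=
  0 < essInf (fun x => ((g x - f x : ℝ) : EReal)) μ

end Exponents

/-! ### Variable Lebesgue and mixed Lebesgue-sequence spaces

The modulars and Luxemburg quasi-norms only involve absolute values of functions, so they are
defined for functions with values in `[0, ∞]`. -/

section Lebesgue

variable {X : Type*} [MeasurableSpace X]

/-- The modular `ρ_{p(·)}(f) = ∫ f(x)^{p(x)} dμ(x)`. -/
noncomputable def modular (p : X → ℝ) (μ : Measure X) (f : X → ℝ≥0∞) : ℝ≥0∞ :=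
  ∫⁻ x, f x ^ p x ∂μ

/-- The Luxemburg quasi-norm of `L^{p(·)}(X, μ)`. -/
noncomputable def lebNorm (p : X → ℝ) (μ : Measure X) (f : X → ℝ≥0∞) : ℝ≥0∞ :=
  sInf {l : ℝ≥0∞ | 0 < l ∧ l < ∞ ∧ modular p μ (fun x => f x / l) ≤ 1}

/-- The pointwise `ℓ^{q(x)}`-quasi-norm of a sequence indexed by `ℤ`, as a function of `x`. -/
noncomputable def seqNorm (q : X → ℝ≥0∞) (g : ℤ → X → ℝ≥0∞) (x : X) : ℝ≥0∞ :=
  if q x = ∞ then ⨆ k, g k x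
  else (∑' k, g k x ^ (q x).toReal) ^ (1 / (q x).toReal)

/-- The quasi-norm of `L^{p(·)}(ℓ^{q(·)}(X, μ))`. -/
noncomputable def lebSeqNorm (p : X → ℝ) (q : X → ℝ≥0∞) (μ : Measure X)
    (g : ℤ → X → ℝ≥0∞) : ℝ≥0∞ :=
  lebNorm p μ (seqNorm q g)

/-- The modular of `ℓ^{q(·)}(L^{p(·)}(X, μ))`; note that `(q x)⁻¹ = 0`, so that
`l ^ (1 / q x) = 1`, where `q x = ∞`. -/
noncomputable def seqLebModular (p : X → ℝ) (q : X → ℝ≥0∞) (μ : Measure X)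
    (g : ℤ → X → ℝ≥0∞) : ℝ≥0∞ :=
  ∑' k, sInf {l : ℝ≥0∞ | 0 < l ∧ l < ∞ ∧
    modular p μ (fun x => g k x / l ^ ((q x)⁻¹).toReal) ≤ 1}

/-- The quasi-norm of `ℓ^{q(·)}(L^{p(·)}(X, μ))`. -/
noncomputable def seqLebNorm (p : X → ℝ) (q : X → ℝ≥0∞) (μ : Measure X)
    (g : ℤ → X → ℝ≥0∞) : ℝ≥0∞ :=
  sInf {l : ℝ≥0∞ | 0 < l ∧ l < ∞ ∧ seqLebModular p q μ (fun k x => g k x / l) ≤ 1}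

/-- The quasi-norm of `L^{p(·)}(X, μ)` on extended real valued functions. -/
noncomputable def lpNorm (p : X → ℝ) (μ : Measure X) (u : X → EReal) : ℝ≥0∞ :=
  lebNorm p μ (fun x => (u x).abs)

/-- The space `L^{p(·)}(X, μ)`: measurable functions with finite modular. -/
def lpSpace (p : X → ℝ) (μ : Measure X) : Set (X → EReal) :=
  {u | Measurable u ∧ modular p μ (fun x => (u x).abs) < ∞}

end Lebesgue

/-! ### Hajłasz-Triebel-Lizorkin and Hajłasz-Besov spaces -/

section Hajlasz

variable {X : Type*} [MetricSpace X] [MeasurableSpace X]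

/-- The collection `𝔻^{s(·)}(u)` of vector `s(·)`-gradients of `u`. -/
def vectorGradients (s : X → ℝ) (μ : Measure X) (u : X → EReal) : Set (ℤ → X → ℝ≥0∞) :=
  {g | (∀ k, Measurable (g k)) ∧ ∃ N : Set X, μ N = 0 ∧
    ∀ (k : ℤ) (x y : X), x ∉ N → y ∉ N →
      (2 : ℝ) ^ (-k - 1) ≤ dist x y → dist x y < (2 : ℝ) ^ (-k) →
      (u x - u y).abs ≤
        ENNReal.ofReal (dist x y ^ s x) * g k x + ENNReal.ofReal (dist x y ^ s y) * g k y}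

/-- The homogeneous Hajłasz-Triebel-Lizorkin quasi-seminorm. -/
noncomputable def homTLNorm (s p : X → ℝ) (q : X → ℝ≥0∞) (μ : Measure X) (u : X → EReal) :
    ℝ≥0∞ :=
  ⨅ g ∈ vectorGradients s μ u, lebSeqNorm p q μ g

/-- The homogeneous Hajłasz-Besov quasi-seminorm. -/
noncomputable def homBesovNorm (s p : X → ℝ) (q : X → ℝ≥0∞) (μ : Measure X) (u : X → EReal) :
    ℝ≥0∞ :=
  ⨅ g ∈ vectorGradients s μ u, seqLebNorm p q μ g

/-- The homogeneous Hajłasz-Triebel-Lizorkin space. -/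
def homTLSpace (s p : X → ℝ) (q : X → ℝ≥0∞) (μ : Measure X) : Set (X → EReal) :=
  {u | Measurable u ∧ (∀ᵐ x ∂μ, u x ≠ ⊥ ∧ u x ≠ ⊤) ∧ homTLNorm s p q μ u < ∞}

/-- The homogeneous Hajłasz-Besov space. -/
def homBesovSpace (s p : X → ℝ) (q : X → ℝ≥0∞) (μ : Measure X) : Set (X → EReal) :=
  {u | Measurable u ∧ (∀ᵐ x ∂μ, u x ≠ ⊥ ∧ u x ≠ ⊤) ∧ homBesovNorm s p q μ u < ∞}

/-- The Hajłasz-Triebel-Lizorkin space `M^{s(·)}_{p(·),q(·)}(X, d, μ)`. -/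
def TLSpace (s p : X → ℝ) (q : X → ℝ≥0∞) (μ : Measure X) : Set (X → EReal) :=
  homTLSpace s p q μ ∩ lpSpace p μ

/-- The Hajłasz-Besov space `N^{s(·)}_{p(·),q(·)}(X, d, μ)`. -/
def BesovSpace (s p : X → ℝ) (q : X → ℝ≥0∞) (μ : Measure X) : Set (X → EReal) :=
  homBesovSpace s p q μ ∩ lpSpace p μ

/-- The quasi-norm of `M^{s(·)}_{p(·),q(·)}(X, d, μ)`. -/
noncomputable def tlNorm (s p : X → ℝ) (q : X → ℝ≥0∞) (μ : Measure X) (u : X → EReal) : ℝ≥0∞ :=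
  lpNorm p μ u + homTLNorm s p q μ u

/-- The quasi-norm of `N^{s(·)}_{p(·),q(·)}(X, d, μ)`. -/
noncomputable def besovNorm (s p : X → ℝ) (q : X → ℝ≥0∞) (μ : Measure X) (u : X → EReal) :
    ℝ≥0∞ :=
  lpNorm p μ u + homBesovNorm s p q μ u

end Hajlasz

/-- Continuous embedding `E ↪ F` of quasi-normed function spaces: `E ⊆ F`, and the inclusion is
bounded. -/
def ContinuouslyEmbeds {X : Type*} (E : Set (X → EReal)) (normE : (X → EReal) → ℝ≥0∞)
    (F : Set (X → EReal)) (normF : (X → EReal) → ℝ≥0∞) : Prop :=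
  E ⊆ F ∧ ∃ C : ℝ≥0∞, C < ∞ ∧ ∀ u ∈ E, normF u ≤ C * normE u

end VarHajlasz

/-! All three embeddings reduce to one scalar statement: if `G` has bounded `p`-modular and `|u(x) -
u(y)| ≤ d^{s(x)} G(x) + d^{s(y)} G(y)` whenever `d = d(x,y) < 1`, then `|u|^γ ≤ K (|u|^p + G^p)`
almost everywhere (`exists_ae_rpow_le`).

The scalar statement is proved by chaining. Lower regularity gives the ball of radius `2^{-j/Q(x)}`
about `x` measure at least `b 2^{-j}`, while by Chebyshev the set where `G^p` or `|u|^p` exceeds `c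
2^j` has smaller measure once `c` is large. So the ball contains a point where both are at most `c
2^j` (`LowerAhlforsRegular.exists_mem_sublevel`). From a point `z` with `G(z)^p` of size `2^n` one
descends through the levels `n, n-1, ..., 0`. The step to level `j` changes `u` by at most a
constant times `2^{-js/Q} 2^{j/p} = 2^{jθ}`, where `θ = 1/p - s/Q`. The exponents may be frozen at
`z`: the points of the chain near level `j` lie within `O(2^{-j/M})` of `z`, where log-Hölder
functions oscillate by `O(1/j)`. Since `sp ≪ Q`, `θ` is bounded below, the geometric sum is
dominated by its largest term, and `|u(z)| ≤ K (1 + G(z)^p)^θ`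
(`ExponentBounds.exists_chain_bound`). As `θγ = 1`, raising to the power `γ` gives the claim.

What remains is to build `G` from a vector gradient. It is a supremum of the normalized `g_k`, with
weights `2^{-εk}` in the third case, where smoothness is given up to pay for the weaker summability.
Rescaling then turns modular bounds into quasi-norm bounds (`continuouslyEmbeds_of_gradient`). -/

namespace VarHajlasz

/-! ### Pointwise Sobolev estimate by chaining through level sets. -/

section Chain

variable {X : Type*} [MetricSpace X]

/-- On points at distance `O(2 ^ (-α j))`, a log-Hölder function oscillates by `O(1 / j)`. -/
theorem LogHolder.mul_abs_sub_le {f : X → ℝ} (hf : LogHolder f) {α D : ℝ} (hα : 0 < α)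
    (hD : 1 ≤ D) :
    ∃ L : ℝ, 0 ≤ L ∧ ∀ (j : ℕ) (x y : X), dist x y ≤ D * (2 : ℝ) ^ (-(α * j)) →
      j * |f x - f y| ≤ L := by
  obtain ⟨C, hC, h⟩ := hf
  have hl2 : 0 < Real.log 2 := Real.log_pos (by norm_num)
  have hlD : 0 ≤ Real.log D := Real.log_nonneg hD
  refine ⟨C * ((1 + Real.log D) / (α * Real.log 2)), by positivity, fun j x y hxy => ?_⟩
  rcases eq_or_ne x y with rfl | hne
  · simp only [sub_self, abs_zero, mul_zero]; positivity
  have hd : 0 < dist x y := dist_pos.2 hne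
  set t := Real.log (Real.exp 1 + 1 / dist x y) with ht
  have ht1 : 1 ≤ t := by
    rw [ht, Real.le_log_iff_exp_le (by positivity)]
    have : 0 < 1 / dist x y := by positivity
    linarith
  have ht2 : -Real.log (dist x y) ≤ t := by
    rw [← Real.log_inv, ht]
    apply Real.log_le_log (by positivity)
    rw [one_div]
    have := Real.exp_pos 1
    linarith
  have hlog : Real.log (dist x y) ≤ Real.log D - α * j * Real.log 2 := by
    have := Real.log_le_log hd hxy
    rw [Real.log_mul (by positivity) (by positivity), Real.log_rpow (by norm_num)] at this
    linarith
  -- `α j log 2 ≤ log D - log d ≤ log D + t ≤ (1 + log D) t`, the last because `t ≥ 1`.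
  have hj : (j : ℝ) ≤ t * ((1 + Real.log D) / (α * Real.log 2)) := by
    rw [← mul_div_assoc, le_div_iff₀ (by positivity)]
    nlinarith
  have ht0 : 0 < t := by linarith
  calc (j : ℝ) * |f x - f y| ≤ j * (C / t) := by gcongr; exact h x y
    _ ≤ (t * ((1 + Real.log D) / (α * Real.log 2))) * (C / t) := by gcongr
    _ = C * ((1 + Real.log D) / (α * Real.log 2)) := by field_simp

/-- Uniform bounds for the exponents on a set `S`. -/
structure ExponentBounds (S : Set X) (Q p s : X → ℝ) (a M ε : ℝ) : Prop where
  a_pos : 0 < a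
  M_pos : 0 < M
  ε_pos : 0 < ε
  le_Q : ∀ x ∈ S, a ≤ Q x
  Q_le : ∀ x ∈ S, Q x ≤ M
  le_p : ∀ x ∈ S, a ≤ p x
  p_le : ∀ x ∈ S, p x ≤ M
  s_pos : ∀ x ∈ S, 0 < s x
  s_le : ∀ x ∈ S, s x ≤ M
  gap : ∀ x ∈ S, ε ≤ Q x - s x * p x

variable {S : Set X} {Q p s : X → ℝ} {a M ε : ℝ}

omit [MetricSpace X] in
-- This uniform lower bound keeps the ratio `2^θ` of the geometric series along the chain away from
-- `1`.
theorem ExponentBounds.theta_ge (h : ExponentBounds S Q p s a M ε) {x : X} (hx : x ∈ S) :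
    ε / (M * M) ≤ 1 / p x - s x / Q x := by
  have hp : 0 < p x := h.a_pos.trans_le (h.le_p x hx)
  have hQ : 0 < Q x := h.a_pos.trans_le (h.le_Q x hx)
  have hM : 0 < M := hp.trans_le (h.p_le x hx)
  have : 1 / p x - s x / Q x = (Q x - s x * p x) / (Q x * p x) := by field_simp
  rw [this]
  have h1 := h.gap x hx
  have h2 := h.Q_le x hx
  have h3 := h.p_le x hx
  have := h.ε_pos
  have h4 : 0 ≤ Q x - s x * p x := by linarith
  gcongr

/-- One link of the chain. -/
theorem ExponentBounds.exists_link_bound (h : ExponentBounds S Q p s a M ε)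
    (hlp : LogHolder fun x => 1 / p x) (hlQ : LogHolder fun x => 1 / Q x)
    (hls : LogHolder fun x => 1 / s x) {α D : ℝ} (hα : 0 < α) (hD : 1 ≤ D) {c : ℝ} (hc : 1 ≤ c) :
    ∃ C : ℝ, 0 < C ∧ ∀ (j : ℕ) (z y v : X), z ∈ S → y ∈ S → v ∈ S →
      dist y z ≤ D * (2 : ℝ) ^ (-(α * j)) → dist v z ≤ D * (2 : ℝ) ^ (-(α * j)) →
      ∀ d g : ℝ, 0 ≤ d → d < (2 : ℝ) ^ (-(j / Q y)) → 0 ≤ g → g ^ p v ≤ c * 2 ^ (j + 1) →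
        d ^ s v * g ≤ C * (2 : ℝ) ^ (j * (1 / p z - s z / Q z)) := by
  obtain ⟨Lp, hLp, hp⟩ := hlp.mul_abs_sub_le hα hD
  obtain ⟨LQ, hLQ, hQ⟩ := hlQ.mul_abs_sub_le hα hD
  obtain ⟨Ls, hLs, hs⟩ := hls.mul_abs_sub_le hα hD
  refine ⟨(c * 2) ^ (1 / a) * (2 : ℝ) ^ (Lp + M * LQ + M * M * Ls / a), by positivity, ?_⟩
  -- `z` is the start of the chain, `y` the centre whose exponent `Q y` sets the radius, and `v`
  -- either endpoint of the link. The level `j + 1` is the one known at `y`.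
  intro j z y v hz hy hv hyz hvz d g hd hdlt hg hgle
  have ha := h.a_pos
  have hpv : 0 < p v := ha.trans_le (h.le_p v hv)
  have hQz : 0 < Q z := ha.trans_le (h.le_Q z hz)
  have hsv := h.s_pos v hv
  have hsz := h.s_pos z hz
  have hM : 0 < M := hsv.trans_le (h.s_le v hv)
  have h1 : d ^ s v ≤ (2 : ℝ) ^ (-(j / Q y * s v)) := by
    rw [← neg_mul, Real.rpow_mul (by norm_num)]
    exact Real.rpow_le_rpow hd hdlt.le hsv.le
  have h2 : g ≤ (c * 2) ^ (1 / a) * (2 : ℝ) ^ (j * (1 / p v)) := by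
    calc g = (g ^ p v) ^ (1 / p v) := by
          rw [← Real.rpow_mul hg, mul_one_div_cancel hpv.ne', Real.rpow_one]
      _ ≤ ((c * 2) * (2 : ℝ) ^ j) ^ (1 / p v) := by
          apply Real.rpow_le_rpow (by positivity) _ (by positivity)
          rw [mul_assoc, ← pow_succ']; exact hgle
      _ = (c * 2) ^ (1 / p v) * (2 : ℝ) ^ (j * (1 / p v)) := by
          rw [Real.mul_rpow (by positivity) (by positivity), ← Real.rpow_natCast,
            ← Real.rpow_mul (by norm_num)]
      _ ≤ _ := by
          gcongr
          · linarith
          · exact h.le_p v hv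
  -- `e1`, `e2`, `e3` are the errors from moving `p`, `Q` and `s` to the point `z`; each is bounded
  -- independently of `j`.
  have e1 : j * (1 / p v - 1 / p z) ≤ Lp :=
    (mul_le_mul_of_nonneg_left (le_abs_self _) (by positivity)).trans (hp j v z hvz)
  have e2 : s v * (j * (1 / Q z - 1 / Q y)) ≤ M * LQ := by
    have : j * (1 / Q z - 1 / Q y) ≤ LQ := by
      refine (mul_le_mul_of_nonneg_left (le_abs_self _) (by positivity)).trans ?_
      rw [abs_sub_comm]; exact hQ j y z hyz
    calc s v * (j * (1 / Q z - 1 / Q y)) ≤ s v * LQ := by gcongr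
      _ ≤ M * LQ := by gcongr; exact h.s_le v hv
  have e3 : j * (s z - s v) / Q z ≤ M * M * Ls / a := by
    -- Log-Hölder continuity is given for `1 / s`; the upper bound on `s` transfers it to `s`.
    have e : j * (s z - s v) = s z * s v * (j * (1 / s v - 1 / s z)) := by
      field_simp
    have : j * (1 / s v - 1 / s z) ≤ Ls :=
      (mul_le_mul_of_nonneg_left (le_abs_self _) (by positivity)).trans (hs j v z hvz)
    have : j * (s z - s v) ≤ M * M * Ls := by
      rw [e]
      calc s z * s v * (j * (1 / s v - 1 / s z)) ≤ s z * s v * Ls := by gcongr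
        _ ≤ M * M * Ls := by
          gcongr
          · exact h.s_le z hz
          · exact h.s_le v hv
    calc j * (s z - s v) / Q z ≤ M * M * Ls / Q z := by gcongr
      _ ≤ M * M * Ls / a := by gcongr; exact h.le_Q z hz
  calc d ^ s v * g
      ≤ (2 : ℝ) ^ (-(j / Q y * s v)) * ((c * 2) ^ (1 / a) * (2 : ℝ) ^ (j * (1 / p v))) := by
        gcongr
    _ = (c * 2) ^ (1 / a) * (2 : ℝ) ^ (j * (1 / p v) - j / Q y * s v) := by
        rw [sub_eq_add_neg, Real.rpow_add (by norm_num)]; ring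
    _ ≤ (c * 2) ^ (1 / a) * (2 : ℝ) ^
          ((Lp + M * LQ + M * M * Ls / a) + j * (1 / p z - s z / Q z)) := by
        gcongr
        · norm_num
        have : j * (1 / p v) - j / Q y * s v = j * (1 / p v - 1 / p z) +
            s v * (j * (1 / Q z - 1 / Q y)) + j * (s z - s v) / Q z
            + j * (1 / p z - s z / Q z) := by ring
        linarith
    _ = _ := by rw [Real.rpow_add (by norm_num), ← mul_assoc]

/-- The chaining estimate: starting from a point where `G ^ p ≤ 2 ^ k`, one descends through the
level sets down to level `0`. -/
theorem ExponentBounds.exists_chain_bound (h : ExponentBounds S Q p s a M ε)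
    (hlp : LogHolder fun x => 1 / p x) (hlQ : LogHolder fun x => 1 / Q x)
    (hls : LogHolder fun x => 1 / s x) {c : ℝ} (hc : 1 ≤ c) :
    ∃ K : ℝ, 1 ≤ K ∧ ∀ T ⊆ S, ∀ (U : X → ℝ) (G : X → ℝ), (∀ x, 0 ≤ G x) →
      (∀ x ∈ T, ∀ j : ℕ, ∃ w ∈ T, dist x w < (2 : ℝ) ^ (-(j / Q x)) ∧ G w ^ p w ≤ c * 2 ^ j ∧
        |U w| ^ p w ≤ c * 2 ^ j) →
      (∀ x ∈ T, ∀ y ∈ T, dist x y < 1 →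
        |U x - U y| ≤ dist x y ^ s x * G x + dist x y ^ s y * G y) →
      ∀ x ∈ T, |U x| ≤ K * (1 + G x ^ p x) ^ (1 / p x - s x / Q x) := by
  have ha := h.a_pos
  have hM : 0 < M := h.M_pos
  set α : ℝ := 1 / M with hαdef
  have hα : 0 < α := by positivity
  have hβ1 : (2 : ℝ) ^ (-α) < 1 := Real.rpow_lt_one_of_one_lt_of_neg (by norm_num) (by linarith)
  have hβ0 : 0 < (2 : ℝ) ^ (-α) := by positivity
  -- Sum of the geometric series of ratio `2^{-α}`: all links down to level `j` have total length at
  -- most `D 2^{-αj}`.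
  set D : ℝ := 1 / (1 - (2 : ℝ) ^ (-α)) with hDdef
  have hD1 : 1 ≤ D := by
    rw [hDdef, le_div_iff₀ (by linarith)]; linarith
  have hDeq : D * (1 - (2 : ℝ) ^ (-α)) = 1 := by
    rw [hDdef]; exact one_div_mul_cancel (by linarith)
  obtain ⟨C, hC, hlink⟩ := h.exists_link_bound hlp hlQ hls hα hD1 hc
  set θ₀ : ℝ := ε / (M * M) with hθ₀
  have hε := h.ε_pos
  have hθ₀pos : 0 < θ₀ := by positivity
  have hτ : 1 < (2 : ℝ) ^ θ₀ := Real.one_lt_rpow (by norm_num) hθ₀pos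
  -- Chosen so that the two endpoint contributions `2C 2^{jθ}` of a link are at most `C₁ (2^{(j+1)θ}
  -- - 2^{jθ})`, which telescopes.
  set C₁ : ℝ := 2 * C / ((2 : ℝ) ^ θ₀ - 1) with hC₁
  have hC₁pos : 0 < C₁ := div_pos (by positivity) (by linarith)
  have hC₁eq : C₁ * ((2 : ℝ) ^ θ₀ - 1) = 2 * C := by
    rw [hC₁]; exact div_mul_cancel₀ _ (by linarith)
  refine ⟨(C₁ + c ^ (1 / a)) * 2 ^ (1 / a), ?_, ?_⟩
  · have h1 : (1 : ℝ) ≤ c ^ (1 / a) := Real.one_le_rpow hc (by positivity)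
    have h2 : (1 : ℝ) ≤ 2 ^ (1 / a) := Real.one_le_rpow (by norm_num) (by positivity)
    nlinarith
  intro T hTS U G hG hpt hgrad z hzT
  have hz := hTS hzT
  set θ : ℝ := 1 / p z - s z / Q z with hθ
  have hθge : θ₀ ≤ θ := h.theta_ge hz
  have hθpos : 0 < θ := hθ₀pos.trans_le hθge
  have hpz : 0 < p z := ha.trans_le (h.le_p z hz)
  have hQz : 0 < Q z := ha.trans_le (h.le_Q z hz)
  have hθle : θ ≤ 1 / a := by
    have h1 : 0 ≤ s z / Q z := div_nonneg (h.s_pos z hz).le hQz.le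
    have h2 : 1 / p z ≤ 1 / a := one_div_le_one_div_of_le ha (h.le_p z hz)
    linarith
  have hGp : 0 ≤ G z ^ p z := Real.rpow_nonneg (hG z) _
  obtain ⟨n, hn1, hn2⟩ := exists_nat_pow_near (x := 1 + G z ^ p z) (y := (2 : ℝ))
    (by linarith) (by norm_num)
  -- Descending induction from level `n + 1`, where the point is `z` itself. Nothing is known about
  -- `|U z|`, hence the restriction `j < n + 1` on that bound. The differences on the right absorb
  -- each link by telescoping.
  have key : ∀ j : ℕ, j ≤ n + 1 → ∃ w ∈ T, G w ^ p w ≤ c * 2 ^ j ∧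
      (j < n + 1 → |U w| ^ p w ≤ c * 2 ^ j) ∧
      dist w z ≤ D * ((2 : ℝ) ^ (-(α * j)) - (2 : ℝ) ^ (-(α * (n + 1 : ℕ)))) ∧
      |U z - U w| ≤ C₁ * ((2 : ℝ) ^ ((n + 1 : ℕ) * θ) - (2 : ℝ) ^ (j * θ)) := by
    intro j hj
    induction hj using Nat.decreasingInduction with
    | self =>
      refine ⟨z, hzT, ?_, fun hlt => absurd hlt (lt_irrefl _), by simp, by simp⟩
      calc G z ^ p z ≤ 1 * 2 ^ (n + 1) := by linarith
        _ ≤ c * 2 ^ (n + 1) := by gcongr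
    | of_succ j hj ih =>
      obtain ⟨y, hyT, hyG, -, hyd, hyU⟩ := ih
      obtain ⟨w, hwT, hwd, hwG, hwU⟩ := hpt y hyT j
      have hy := hTS hyT
      have hw := hTS hwT
      have hQy : 0 < Q y := ha.trans_le (h.le_Q y hy)
      have hj0 : (0 : ℝ) ≤ j := by positivity
      have hd1 : dist y w < 1 := hwd.trans_le
        (Real.rpow_le_one_of_one_le_of_nonpos (by norm_num) (by
          have : 0 ≤ (j : ℝ) / Q y := by positivity
          linarith))
      have hdα : dist y w ≤ (2 : ℝ) ^ (-(α * j)) := by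
        refine hwd.le.trans (Real.rpow_le_rpow_of_exponent_le (by norm_num) ?_)
        rw [neg_le_neg_iff, hαdef, one_div_mul_eq_div]
        gcongr
        exact h.Q_le y hy
      have hpow : (2 : ℝ) ^ (-(α * (j + 1 : ℕ))) = (2 : ℝ) ^ (-(α * j)) * (2 : ℝ) ^ (-α) := by
        rw [← Real.rpow_add (by norm_num)]; push_cast; ring_nf
      have hb : 0 < (2 : ℝ) ^ (-(α * j)) := by positivity
      have hn0 : 0 < (2 : ℝ) ^ (-(α * (n + 1 : ℕ))) := by positivity
      have hwz : dist w z ≤ D * ((2 : ℝ) ^ (-(α * j)) - (2 : ℝ) ^ (-(α * (n + 1 : ℕ)))) := by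
        have h1 := dist_triangle w y z
        rw [dist_comm w y] at h1
        rw [hpow] at hyd
        have h2 : D * (2 : ℝ) ^ (-(α * j)) - D * ((2 : ℝ) ^ (-(α * j)) * (2 : ℝ) ^ (-α))
            = (2 : ℝ) ^ (-(α * j)) := by
          linear_combination (2 : ℝ) ^ (-(α * j)) * hDeq
        linarith
      have hwz' : dist w z ≤ D * (2 : ℝ) ^ (-(α * j)) :=
        hwz.trans (by gcongr; linarith)
      have hyz' : dist y z ≤ D * (2 : ℝ) ^ (-(α * j)) := by
        refine hyd.trans ?_
        gcongr
        rw [hpow]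
        nlinarith
      have l1 := hlink j z y y hz hy hy hyz' hyz' (dist y w) (G y) dist_nonneg hwd (hG y) hyG
      have l2 := hlink j z y w hz hy hw hyz' hwz' (dist y w) (G w) dist_nonneg hwd (hG w)
        (hwG.trans (by gcongr <;> norm_num))
      refine ⟨w, hwT, hwG, fun _ => hwU, hwz, ?_⟩
      have hstep := hgrad y hyT w hwT hd1
      have htri : |U z - U w| ≤ |U z - U y| + |U y - U w| := abs_sub_le _ _ _
      have hpow2 : (2 : ℝ) ^ ((j + 1 : ℕ) * θ) = (2 : ℝ) ^ (j * θ) * (2 : ℝ) ^ θ := by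
        rw [← Real.rpow_add (by norm_num)]; push_cast; ring_nf
      rw [hpow2] at hyU
      have hb2 : 0 < (2 : ℝ) ^ (j * θ) := by positivity
      have hτθ : (2 : ℝ) ^ θ₀ ≤ (2 : ℝ) ^ θ :=
        Real.rpow_le_rpow_of_exponent_le (by norm_num) hθge
      have hfin : 2 * C * (2 : ℝ) ^ (j * θ) ≤
          C₁ * ((2 : ℝ) ^ (j * θ) * (2 : ℝ) ^ θ - (2 : ℝ) ^ (j * θ)) := by
        calc 2 * C * (2 : ℝ) ^ (j * θ) = C₁ * ((2 : ℝ) ^ θ₀ - 1) * (2 : ℝ) ^ (j * θ) := by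
              rw [hC₁eq]
          _ ≤ C₁ * ((2 : ℝ) ^ θ - 1) * (2 : ℝ) ^ (j * θ) := by gcongr
          _ = _ := by ring
      linarith
  -- At level `0` the value of `U` is bounded by a constant, which closes the chain.
  obtain ⟨w, hwT, -, hwU, -, hzw⟩ := key 0 (Nat.zero_le _)
  have hw := hTS hwT
  have hwU := hwU (Nat.succ_pos n)
  have hpw : 0 < p w := ha.trans_le (h.le_p w hw)
  have hUw : |U w| ≤ c ^ (1 / a) := by
    calc |U w| = (|U w| ^ p w) ^ (1 / p w) := by
          rw [← Real.rpow_mul (abs_nonneg _), mul_one_div_cancel hpw.ne', Real.rpow_one]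
      _ ≤ c ^ (1 / p w) := by
          apply Real.rpow_le_rpow (by positivity) _ (by positivity)
          simpa using hwU
      _ ≤ c ^ (1 / a) := by
          gcongr
          exact h.le_p w hw
  have hone : 1 ≤ (1 + G z ^ p z) ^ θ := Real.one_le_rpow (by linarith) hθpos.le
  have hbig : (2 : ℝ) ^ ((n + 1 : ℕ) * θ) ≤ 2 ^ (1 / a) * (1 + G z ^ p z) ^ θ := by
    rw [Real.rpow_mul (by norm_num), Real.rpow_natCast, pow_succ',
      Real.mul_rpow (by norm_num) (by positivity)]
    gcongr
    norm_num
  have h2a : (1 : ℝ) ≤ 2 ^ (1 / a) := Real.one_le_rpow (by norm_num) (by positivity)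
  have hca : (0 : ℝ) ≤ c ^ (1 / a) := by positivity
  have hprod : 1 ≤ 2 ^ (1 / a) * (1 + G z ^ p z) ^ θ := by nlinarith
  have habs : |U z| ≤ |U z - U w| + |U w| := by
    have := abs_add_le (U z - U w) (U w)
    simpa using this
  have hz1 : |U z - U w| ≤ C₁ * (2 ^ (1 / a) * (1 + G z ^ p z) ^ θ) := by
    refine hzw.trans (mul_le_mul_of_nonneg_left ?_ hC₁pos.le)
    exact (sub_le_self _ (by positivity)).trans hbig
  calc |U z| ≤ C₁ * (2 ^ (1 / a) * (1 + G z ^ p z) ^ θ) + c ^ (1 / a) * 1 := by linarith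
    _ ≤ C₁ * (2 ^ (1 / a) * (1 + G z ^ p z) ^ θ)
        + c ^ (1 / a) * (2 ^ (1 / a) * (1 + G z ^ p z) ^ θ) := by gcongr
    _ = _ := by ring

omit [MetricSpace X] in
-- The lower bound `p` lets `U^p` control `U^γ` where `U` is bounded; the upper bound makes
-- constants raised to the power `γ` uniform.
theorem ExponentBounds.sobolev_exponent_mem (h : ExponentBounds S Q p s a M ε) {x : X}
    (hx : x ∈ S) :
    p x ≤ Q x * p x / (Q x - s x * p x) ∧ Q x * p x / (Q x - s x * p x) ≤ M * M / ε := by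
  have hp : 0 < p x := h.a_pos.trans_le (h.le_p x hx)
  have hs := h.s_pos x hx
  have hε := h.ε_pos
  have hM := h.M_pos
  have h1 := h.gap x hx
  have h2 := h.Q_le x hx
  have h3 := h.p_le x hx
  constructor
  · rw [le_div_iff₀ (hε.trans_le h1)]
    have : 0 < s x * p x * p x := by positivity
    nlinarith
  · gcongr

omit [MetricSpace X] in
/-- The pointwise Sobolev inequality. -/
theorem ExponentBounds.exists_rpow_bound (h : ExponentBounds S Q p s a M ε)
    {K : ℝ} (hK : 1 ≤ K) :
    ∃ K' : ℝ, 0 ≤ K' ∧ ∀ x ∈ S, ∀ U G : ℝ, 0 ≤ U → 0 ≤ G →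
      U ≤ K * (1 + G ^ p x) ^ (1 / p x - s x / Q x) →
      U ^ (Q x * p x / (Q x - s x * p x)) ≤ K' * (U ^ p x + G ^ p x) := by
  set Γ : ℝ := M * M / ε with hΓ
  set B : ℝ := K * 2 ^ (1 / a) with hB
  have ha := h.a_pos
  have hε := h.ε_pos
  have h2a : (1 : ℝ) ≤ 2 ^ (1 / a) := Real.one_le_rpow (by norm_num) (by positivity)
  have hB1 : 1 ≤ B := by nlinarith
  have hKB : K ≤ B := by nlinarith
  refine ⟨B ^ Γ * 2, by positivity, fun x hx U G hU hG hle => ?_⟩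
  have hp : 0 < p x := ha.trans_le (h.le_p x hx)
  have hQ : 0 < Q x := ha.trans_le (h.le_Q x hx)
  have hs := h.s_pos x hx
  have hgap : 0 < Q x - s x * p x := hε.trans_le (h.gap x hx)
  have hM : 0 < M := hs.trans_le (h.s_le x hx)
  set γ : ℝ := Q x * p x / (Q x - s x * p x) with hγ
  set θ : ℝ := 1 / p x - s x / Q x with hθ
  have hθγ : θ * γ = 1 := by
    have : θ = (Q x - s x * p x) / (Q x * p x) := by rw [hθ]; field_simp
    rw [this, hγ]
    exact div_mul_div_cancel₀' hgap.ne' _ _ |>.trans (div_self (by positivity))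
  have hγpos : 0 < γ := by positivity
  have hθpos : 0 < θ := by
    by_contra hcon
    nlinarith
  obtain ⟨hpγ, hγΓ⟩ : p x ≤ γ ∧ γ ≤ Γ := h.sobolev_exponent_mem hx
  have hθle : θ ≤ 1 / a := by
    have h1 : 0 ≤ s x / Q x := by positivity
    have h2 : 1 / p x ≤ 1 / a := one_div_le_one_div_of_le ha (h.le_p x hx)
    linarith
  have hUp : 0 ≤ U ^ p x := Real.rpow_nonneg hU _
  have hGp : 0 ≤ G ^ p x := Real.rpow_nonneg hG _
  have hBΓ : 0 ≤ B ^ Γ := by positivity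
  -- If `G^p ≤ 1` then `U ≤ B`, and the surplus power `U^{γ-p}` is bounded. Otherwise `1 + G^p ≤ 2
  -- G^p`, and `θγ = 1` applies directly.
  rcases le_total (G ^ p x) 1 with hG1 | hG1
  · have hUB : U ≤ B := by
      refine hle.trans ?_
      rw [hB]
      gcongr
      calc (1 + G ^ p x) ^ θ ≤ 2 ^ θ := by gcongr; linarith
        _ ≤ 2 ^ (1 / a) := by gcongr; norm_num
    have : U ^ γ ≤ U ^ p x * B ^ Γ := by
      calc U ^ γ = U ^ p x * U ^ (γ - p x) := by
            rw [← Real.rpow_add_of_nonneg hU hp.le (by linarith)]; ring_nf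
        _ ≤ U ^ p x * B ^ (γ - p x) := by gcongr
        _ ≤ U ^ p x * B ^ Γ := by
            gcongr
            linarith
    nlinarith [mul_nonneg hBΓ hUp, mul_nonneg hBΓ hGp]
  · calc U ^ γ ≤ (K * (1 + G ^ p x) ^ θ) ^ γ := by gcongr
      _ = K ^ γ * (1 + G ^ p x) := by
          rw [Real.mul_rpow (by linarith) (by positivity), ← Real.rpow_mul (by positivity), hθγ,
            Real.rpow_one]
      _ ≤ B ^ Γ * (2 * (U ^ p x + G ^ p x)) := by
          gcongr
          · calc K ^ γ ≤ B ^ γ := by gcongr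
              _ ≤ B ^ Γ := by gcongr
          · linarith
      _ = _ := by ring

end Chain

/-! ### Good points in small balls and the almost everywhere Sobolev inequality. -/

section AeBound

variable {X : Type*} [MetricSpace X] [MeasurableSpace X] {μ : Measure X}

theorem IsBddLogExponent.exists_bounds {p : X → ℝ} (hp : IsBddLogExponent p μ) :
    ∃ a M : ℝ, 0 < a ∧ ∀ᵐ x ∂μ, a ≤ p x ∧ p x ≤ M := by
  obtain ⟨a, ha0, ha⟩ := exists_between hp.essInf_pos
  obtain ⟨M, hM, hMtop⟩ := exists_between hp.essSup_lt_top
  rcases eq_or_ne a ∞ with rfl | hat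
  · refine ⟨1, 1, one_pos, ?_⟩
    filter_upwards [ae_lt_of_lt_essInf ha] with x hx
    simp at hx
  refine ⟨a.toReal, M.toReal, ENNReal.toReal_pos ha0.ne' hat, ?_⟩
  filter_upwards [ae_lt_of_lt_essInf ha, ae_lt_of_essSup_lt hM] with x h1 h2
  refine ⟨ENNReal.toReal_le_of_le_ofReal (hp.pos x).le h1.le, ?_⟩
  exact (ENNReal.ofReal_le_iff_le_toReal hMtop.ne).1 h2.le

omit [MetricSpace X] in
theorem MuchLess.exists_gap {f g : X → ℝ} (h : MuchLess f g μ) :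
    ∃ ε : ℝ, 0 < ε ∧ ∀ᵐ x ∂μ, ε ≤ g x - f x := by
  obtain ⟨ε, h0, hε⟩ := EReal.lt_iff_exists_real_btwn.1 h
  refine ⟨ε, by exact_mod_cast h0, ?_⟩
  filter_upwards [ae_lt_of_lt_essInf hε] with x hx
  exact_mod_cast hx.le

theorem exists_exponentBounds {Q p s : X → ℝ} (hQ : IsBddLogExponent Q μ)
    (hp : IsBddLogExponent p μ) (hs : IsBddLogExponent s μ)
    (hgap : MuchLess (fun x => s x * p x) Q μ) :
    ∃ (T : Set X) (a M ε : ℝ), (∀ᵐ x ∂μ, x ∈ T) ∧ ExponentBounds T Q p s a M ε := by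
  obtain ⟨a₁, M₁, ha₁, h₁⟩ := hQ.exists_bounds
  obtain ⟨a₂, M₂, ha₂, h₂⟩ := hp.exists_bounds
  obtain ⟨a₃, M₃, -, h₃⟩ := hs.exists_bounds
  obtain ⟨ε, hε, h₄⟩ := hgap.exists_gap
  refine ⟨{x | (a₁ ≤ Q x ∧ Q x ≤ M₁) ∧ (a₂ ≤ p x ∧ p x ≤ M₂) ∧ s x ≤ M₃ ∧
    ε ≤ Q x - s x * p x}, min a₁ a₂, max 1 (max M₁ (max M₂ M₃)), ε, ?_, ?_⟩
  · filter_upwards [h₁, h₂, h₃, h₄] with x h1 h2 h3 h4 using ⟨h1, h2, h3.2, h4⟩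
  · exact
      { a_pos := lt_min ha₁ ha₂
        M_pos := lt_max_of_lt_left one_pos
        ε_pos := hε
        le_Q := fun x hx => (min_le_left _ _).trans hx.1.1
        Q_le := fun x hx => hx.1.2.trans (by simp)
        le_p := fun x hx => (min_le_right _ _).trans hx.2.1.1
        p_le := fun x hx => hx.2.1.2.trans (by simp)
        s_pos := fun x _ => hs.pos x
        s_le := fun x hx => hx.2.2.1.trans (by simp)
        gap := fun x hx => hx.2.2.2 }

/-- Under lower Ahlfors regularity every ball `B(x, 2 ^ (-j / Q x))` meets the level-`2 ^ j`
sublevel sets of two functions with bounded integral. -/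
theorem LowerAhlforsRegular.exists_mem_sublevel {Q : X → ℝ} (hreg : LowerAhlforsRegular Q μ)
    {A : ℝ} (hA : 0 ≤ A) :
    ∃ c : ℝ, 1 ≤ c ∧ ∀ S : Set X, (∀ᵐ x ∂μ, x ∈ S) → ∀ f g : X → ℝ≥0∞, Measurable f →
      Measurable g → ∫⁻ x, f x ∂μ ≤ ENNReal.ofReal A → ∫⁻ x, g x ∂μ ≤ ENNReal.ofReal A →
      ∀ x, 0 < Q x → ∀ j : ℕ, ∃ w ∈ S, dist x w < (2 : ℝ) ^ (-(j / Q x)) ∧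
        f w ≤ ENNReal.ofReal (c * 2 ^ j) ∧ g w ≤ ENNReal.ofReal (c * 2 ^ j) := by
  obtain ⟨b, hb, hreg⟩ := hreg
  -- This `c` satisfies `c b > 2A`, where `2A` is the sum of the two Chebyshev bounds.
  refine ⟨(2 * A + 1) / b + 1, by
    have : 0 ≤ (2 * A + 1) / b := by positivity
    linarith, ?_⟩
  intro S hS f g hf hg hfA hgA x hQ j
  set c := (2 * A + 1) / b + 1 with hc
  have hcb : 2 * A + 1 ≤ c * b := by
    rw [hc, add_mul, div_mul_cancel₀ _ hb.ne']; linarith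
  have hc0 : 0 < c := by rw [hc]; positivity
  by_contra! hcon
  set e := ENNReal.ofReal (c * 2 ^ j) with he
  set r : ℝ := (2 : ℝ) ^ (-(j / Q x)) with hr
  have hr0 : 0 < r := by positivity
  have hr1 : r ≤ 1 := Real.rpow_le_one_of_one_le_of_nonpos (by norm_num) (by
    have : 0 ≤ (j : ℝ) / Q x := by positivity
    linarith)
  have hrQ : r ^ Q x = ((2 : ℝ) ^ j)⁻¹ := by
    rw [hr, ← Real.rpow_mul (by norm_num), neg_mul, div_mul_cancel₀ _ hQ.ne',
      Real.rpow_neg (by norm_num), Real.rpow_natCast]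
  have hball := hreg x r hr0 hr1
  have hsub : Metric.ball x r ⊆ (Sᶜ ∪ {w | e ≤ f w}) ∪ {w | e ≤ g w} := by
    intro w hw
    rw [Metric.mem_ball, dist_comm] at hw
    by_cases hwS : w ∈ S
    · by_cases hfw : f w ≤ e
      · exact Or.inr (hcon w hwS hw hfw).le
      · exact Or.inl (Or.inr (not_le.1 hfw).le)
    · exact Or.inl (Or.inl hwS)
  have hSc : μ Sᶜ = 0 := hS
  have hm : μ (Metric.ball x r) ≤ μ {w | e ≤ f w} + μ {w | e ≤ g w} := by
    refine (measure_mono hsub).trans ((measure_union_le _ _).trans ?_)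
    refine add_le_add ?_ le_rfl
    refine (measure_union_le _ _).trans ?_
    rw [hSc, zero_add]
  have h1 := (mul_meas_ge_le_lintegral (μ := μ) hf e).trans hfA
  have h2 := (mul_meas_ge_le_lintegral (μ := μ) hg e).trans hgA
  -- Since `r^Q = 2^{-j}`, the level `c 2^j` times the lower bound for the ball is exactly `c b`,
  -- independent of `j` and `x`.
  have h3 : ENNReal.ofReal (c * b) ≤ ENNReal.ofReal (A + A) := by
    calc ENNReal.ofReal (c * b) = e * ENNReal.ofReal (b * r ^ Q x) := by
          rw [he, ← ENNReal.ofReal_mul (by positivity), hrQ]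
          congr 1
          field_simp
      _ ≤ e * (μ {w | e ≤ f w} + μ {w | e ≤ g w}) := by gcongr; exact hball.trans hm
      _ ≤ ENNReal.ofReal A + ENNReal.ofReal A := by rw [mul_add]; exact add_le_add h1 h2
      _ = _ := (ENNReal.ofReal_add hA hA).symm
  have := (ENNReal.ofReal_le_ofReal_iff (by positivity)).1 h3
  linarith

/-- Pointwise a.e. Sobolev inequality for functions whose gradient controls the differences at
distances less than `1`. -/
theorem exists_ae_rpow_le {Q p s : X → ℝ} (hQ : IsBddLogExponent Q μ)
    (hreg : LowerAhlforsRegular Q μ) (hp : IsBddLogExponent p μ) (hs : IsBddLogExponent s μ)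
    (hgap : MuchLess (fun x => s x * p x) Q μ) {A : ℝ} (hA : 0 ≤ A) :
    ∃ K : ℝ, 0 ≤ K ∧ ∀ (V : X → ℝ) (G : X → ℝ≥0∞), Measurable V → Measurable G →
      modular p μ (fun x => ENNReal.ofReal |V x|) ≤ ENNReal.ofReal A →
      modular p μ G ≤ ENNReal.ofReal A →
      ∀ N : Set X, μ N = 0 →
      (∀ x y, x ∉ N → y ∉ N → x ≠ y → dist x y < 1 → ENNReal.ofReal |V x - V y| ≤
        ENNReal.ofReal (dist x y ^ s x) * G x + ENNReal.ofReal (dist x y ^ s y) * G y) →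
      ∀ᵐ x ∂μ, ENNReal.ofReal |V x| ^ (Q x * p x / (Q x - s x * p x)) ≤
        ENNReal.ofReal K * (ENNReal.ofReal |V x| ^ p x + G x ^ p x) := by
  obtain ⟨T, a, M, ε, hT, hE⟩ := exists_exponentBounds hQ hp hs hgap
  obtain ⟨c, hc, hlevel⟩ := hreg.exists_mem_sublevel hA
  obtain ⟨K, hK, hchain⟩ := hE.exists_chain_bound hp.logHolder hQ.logHolder hs.logHolder hc
  obtain ⟨K', hK', hfin⟩ := hE.exists_rpow_bound hK
  refine ⟨K', hK', fun V G hV hG hVA hGA N hN hgrad => ?_⟩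
  have hGfin : ∀ᵐ x ∂μ, G x < ∞ := by
    have h1 : ∀ᵐ x ∂μ, G x ^ p x < ∞ :=
      ae_lt_top (hG.pow hp.measurable) (hGA.trans_lt ENNReal.ofReal_lt_top).ne
    filter_upwards [h1] with x hx
    by_contra hcon
    rw [not_lt, top_le_iff] at hcon
    rw [hcon, ENNReal.top_rpow_of_pos (hp.pos x)] at hx
    exact lt_irrefl _ hx
  have hNae : ∀ᵐ x ∂μ, x ∉ N := measure_eq_zero_iff_ae_notMem.1 hN
  -- The whole chain has to run in this set of full measure, where the exponent bounds and the
  -- gradient inequality hold pointwise and `G` is finite.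
  set S : Set X := {x | x ∈ T ∧ x ∉ N ∧ G x < ∞} with hSdef
  have hS : ∀ᵐ x ∂μ, x ∈ S := by
    filter_upwards [hT, hNae, hGfin] with x h1 h2 h3 using ⟨h1, h2, h3⟩
  have hGreal : ∀ x, G x < ∞ → G x = ENNReal.ofReal (G x).toReal := fun x hx =>
    (ENNReal.ofReal_toReal hx.ne).symm
  have hbound := hchain S (fun x hx => hx.1) V (fun x => (G x).toReal)
    (fun x => ENNReal.toReal_nonneg) ?_ ?_
  · filter_upwards [hS] with x hx
    have h1 := hfin x hx.1 |V x| (G x).toReal (abs_nonneg _) ENNReal.toReal_nonneg (hbound x hx)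
    have hgap' : 0 < Q x - s x * p x := hE.ε_pos.trans_le (hE.gap x hx.1)
    have hQx := hQ.pos x
    have hpx := hp.pos x
    rw [hGreal x hx.2.2, ENNReal.ofReal_rpow_of_nonneg (abs_nonneg _) (by positivity),
      ENNReal.ofReal_rpow_of_nonneg (abs_nonneg _) hpx.le,
      ENNReal.ofReal_rpow_of_nonneg ENNReal.toReal_nonneg hpx.le,
      ← ENNReal.ofReal_add (by positivity) (by positivity), ← ENNReal.ofReal_mul hK']
    exact ENNReal.ofReal_le_ofReal h1
  · intro x hx j
    obtain ⟨w, hwS, hwd, hw1, hw2⟩ := hlevel S hS (fun x => G x ^ p x)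
      (fun x => ENNReal.ofReal |V x| ^ p x) (hG.pow hp.measurable)
      ((ENNReal.measurable_ofReal.comp hV.abs).pow hp.measurable) hGA hVA x (hQ.pos x) j
    have hpw := hp.pos w
    refine ⟨w, hwS, hwd, ?_, ?_⟩
    · rw [hGreal w hwS.2.2, ENNReal.ofReal_rpow_of_nonneg ENNReal.toReal_nonneg hpw.le] at hw1
      exact (ENNReal.ofReal_le_ofReal_iff (by positivity)).1 hw1
    · rw [ENNReal.ofReal_rpow_of_nonneg (abs_nonneg _) hpw.le] at hw2
      exact (ENNReal.ofReal_le_ofReal_iff (by positivity)).1 hw2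
  · intro x hx y hy hd
    rcases eq_or_ne x y with rfl | hne
    · simp only [sub_self, abs_zero]; positivity
    have h1 := hgrad x y hx.2.1 hy.2.1 hne hd
    rw [hGreal x hx.2.2, hGreal y hy.2.2, ← ENNReal.ofReal_mul (by positivity),
      ← ENNReal.ofReal_mul (by positivity), ← ENNReal.ofReal_add (by positivity) (by positivity)]
      at h1
    exact (ENNReal.ofReal_le_ofReal_iff (by positivity)).1 h1

end AeBound

/-! ### Modulars, Luxemburg quasi-norms and mixed sequence modulars. -/

section Modular

variable {X : Type*} [MeasurableSpace X] {μ : Measure X}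

theorem modular_div_le_one_of_lebNorm_lt {p : X → ℝ} (hp : ∀ x, 0 < p x) {f : X → ℝ≥0∞}
    {L : ℝ≥0∞} (h : lebNorm p μ f < L) : modular p μ (fun x => f x / L) ≤ 1 := by
  obtain ⟨l, ⟨-, -, hl⟩, hlL⟩ := sInf_lt_iff.1 h
  refine le_trans (lintegral_mono fun x => ?_) hl
  exact ENNReal.rpow_le_rpow (ENNReal.div_le_div_left hlL.le _) (hp x).le

/-- If the modular is at most `B ≥ 1`, then dividing by `B ^ (1 / a)` makes it at most `1`. -/
theorem modular_div_rpow_le_one {r : X → ℝ} {a : ℝ} (ha : 0 < a) (hr : ∀ᵐ x ∂μ, a ≤ r x)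
    {f : X → ℝ≥0∞} {B : ℝ≥0∞} (hB : 1 ≤ B) (hBtop : B ≠ ∞) (h : modular r μ f ≤ B) :
    modular r μ (fun x => f x / B ^ (1 / a)) ≤ 1 := by
  have hB0 : B ≠ 0 := (zero_lt_one.trans_le hB).ne'
  calc modular r μ (fun x => f x / B ^ (1 / a)) ≤ ∫⁻ x, B⁻¹ * f x ^ r x ∂μ := by
        refine lintegral_mono_ae ?_
        filter_upwards [hr] with x hx
        rw [ENNReal.div_rpow_of_nonneg _ _ (ha.le.trans hx), div_eq_mul_inv, mul_comm,
          ← ENNReal.rpow_mul]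
        gcongr
        calc B = B ^ (1 : ℝ) := (ENNReal.rpow_one B).symm
          _ ≤ B ^ (1 / a * r x) := by
            refine ENNReal.rpow_le_rpow_of_exponent_le hB ?_
            rw [one_div, inv_mul_eq_div, one_le_div ha]
            exact hx
    _ = B⁻¹ * modular r μ f := lintegral_const_mul' _ _ (ENNReal.inv_ne_top.2 hB0)
    _ ≤ B⁻¹ * B := by gcongr
    _ = 1 := ENNReal.inv_mul_cancel hB0 hBtop

theorem lebNorm_lt_top {r : X → ℝ} {a : ℝ} (ha : 0 < a) (hr : ∀ᵐ x ∂μ, a ≤ r x)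
    {f : X → ℝ≥0∞} (h : modular r μ f < ∞) : lebNorm r μ f < ∞ := by
  have hB : (1 : ℝ≥0∞) ≤ max 1 (modular r μ f) := le_max_left _ _
  have hBtop : max 1 (modular r μ f) < ∞ := max_lt ENNReal.one_lt_top h
  have hC : max 1 (modular r μ f) ^ (1 / a) < ∞ :=
    ENNReal.rpow_lt_top_of_nonneg (by positivity) hBtop.ne
  refine lt_of_le_of_lt (sInf_le ⟨?_, hC, ?_⟩) hC
  · exact ENNReal.rpow_pos (zero_lt_one.trans_le hB) hBtop.ne
  · exact modular_div_rpow_le_one ha hr hB hBtop.ne (le_max_right _ _)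

/-- At each point the supremum of a sequence is at most its `ℓ^{p(x)}` quasi-norm. -/
theorem modular_iSup_le {ι : Type*} [Countable ι] {p : X → ℝ} (hpm : Measurable p)
    (hp : ∀ x, 0 < p x) {h : ι → X → ℝ≥0∞} (hh : ∀ k, Measurable (h k)) :
    modular p μ (fun x => ⨆ k, h k x) ≤ ∑' k, modular p μ (h k) := by
  rw [show ∑' k, modular p μ (h k) = ∫⁻ x, ∑' k, h k x ^ p x ∂μ from
    (lintegral_tsum fun k => ((hh k).pow hpm).aemeasurable).symm]
  refine lintegral_mono fun x => ?_
  have : ⨆ k, h k x ≤ (∑' k, h k x ^ p x) ^ (p x)⁻¹ := by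
    refine iSup_le fun k => ?_
    rw [ENNReal.le_rpow_inv_iff (hp x)]
    exact ENNReal.le_tsum k
  exact (ENNReal.le_rpow_inv_iff (hp x)).1 this

omit [MeasurableSpace X] in
theorem le_seqNorm {q : X → ℝ≥0∞} {x : X} (hq : 0 < q x) (g : ℤ → X → ℝ≥0∞) (k : ℤ) :
    g k x ≤ seqNorm q g x := by
  unfold seqNorm
  split_ifs with h
  · exact le_iSup (fun k => g k x) k
  · have hq' : 0 < (q x).toReal := ENNReal.toReal_pos hq.ne' h
    rw [one_div, ENNReal.le_rpow_inv_iff hq']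
    exact ENNReal.le_tsum (f := fun k => g k x ^ (q x).toReal) k

/-- Removing the weight `l ^ (1 / q)` from a modular. -/
theorem modular_le_of_weight {p : X → ℝ} (hp : ∀ x, 0 < p x) {q : X → ℝ≥0∞} {h : X → ℝ≥0∞}
    {l W : ℝ≥0∞} (hl0 : 0 < l) (hl : l < ∞) (hWtop : W ≠ ∞)
    (hW : ∀ᵐ x ∂μ, l ^ ((q x)⁻¹.toReal * p x) ≤ W)
    (hm : modular p μ (fun x => h x / l ^ ((q x)⁻¹).toReal) ≤ 1) : modular p μ h ≤ W := by
  calc modular p μ h ≤ ∫⁻ x, W * (h x / l ^ ((q x)⁻¹).toReal) ^ p x ∂μ := by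
        refine lintegral_mono_ae ?_
        filter_upwards [hW] with x hx
        have h0 : l ^ ((q x)⁻¹).toReal ≠ 0 := (ENNReal.rpow_pos hl0 hl.ne).ne'
        have ht : l ^ ((q x)⁻¹).toReal ≠ ∞ :=
          ENNReal.rpow_ne_top_of_nonneg ENNReal.toReal_nonneg hl.ne
        calc h x ^ p x = (l ^ ((q x)⁻¹).toReal * (h x / l ^ ((q x)⁻¹).toReal)) ^ p x := by
              rw [ENNReal.mul_div_cancel h0 ht]
          _ = l ^ ((q x)⁻¹.toReal * p x) * (h x / l ^ ((q x)⁻¹).toReal) ^ p x := by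
              rw [ENNReal.mul_rpow_of_nonneg _ _ (hp x).le, ← ENNReal.rpow_mul]
          _ ≤ _ := by gcongr
    _ = W * modular p μ (fun x => h x / l ^ ((q x)⁻¹).toReal) := lintegral_const_mul' _ _ hWtop
    _ ≤ W * 1 := by gcongr
    _ = W := mul_one W

/-- `p/q` is the power with which a weight `λ_k` leaves the modular; it is bounded because `q` is
bounded away from zero and `p` is bounded. -/
theorem IsExponent.exists_mul_le {q : X → ℝ≥0∞} (hq : IsExponent q μ) {p : X → ℝ}
    (hp : ∀ x, 0 < p x) {M : ℝ} (hM : ∀ᵐ x ∂μ, p x ≤ M) :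
    ∃ κ : ℝ, 0 ≤ κ ∧ ∀ᵐ x ∂μ, (q x)⁻¹.toReal * p x ≤ κ := by
  obtain ⟨b, hb0, hb⟩ := exists_between hq.essInf_pos
  refine ⟨b⁻¹.toReal * max 0 M, by positivity, ?_⟩
  filter_upwards [ae_lt_of_lt_essInf hb, hM] with x h1 h2
  have := (hp x).le
  gcongr
  · exact ENNReal.inv_ne_top.2 hb0.ne'
  · exact h2.trans (le_max_right _ _)

/-- `ℓ^q(L^p)` is contained in `ℓ^∞(L^p)`. -/
theorem modular_le_of_seqLebModular_le_one {p : X → ℝ} (hp : ∀ x, 0 < p x) {q : X → ℝ≥0∞}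
    {κ : ℝ} (hκ : 0 ≤ κ) (hq : ∀ᵐ x ∂μ, (q x)⁻¹.toReal * p x ≤ κ) {h : ℤ → X → ℝ≥0∞}
    (hm : seqLebModular p q μ h ≤ 1) (k : ℤ) : modular p μ (h k) ≤ 2 ^ κ := by
  -- The infimum is at most `1` but need not be attained; the slack up to `2` yields an admissible
  -- `l < 2`.
  have hlt : _ < (2 : ℝ≥0∞) := ((ENNReal.le_tsum k).trans hm).trans_lt ENNReal.one_lt_two
  obtain ⟨l, ⟨hl0, hltop, hl⟩, hl2⟩ := sInf_lt_iff.1 hlt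
  refine modular_le_of_weight hp hl0 hltop
    (ENNReal.rpow_ne_top_of_nonneg hκ ENNReal.ofNat_ne_top) ?_ hl
  filter_upwards [hq] with x hx
  have : 0 ≤ (q x)⁻¹.toReal * p x := mul_nonneg ENNReal.toReal_nonneg (hp x).le
  exact (ENNReal.rpow_le_rpow hl2.le this).trans
    (ENNReal.rpow_le_rpow_of_exponent_le ENNReal.one_lt_two.le hx)

/-- For `q ≤ p`, `ℓ^q(L^p)` is contained in `ℓ^p(L^p)`. -/
theorem tsum_modular_le_of_seqLebModular_le_one {p : X → ℝ} (hp : ∀ x, 0 < p x)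
    {q : X → ℝ≥0∞} (hq0 : ∀ x, 0 < q x) (hqp : ∀ x, q x ≤ ENNReal.ofReal (p x))
    {κ : ℝ} (hκ : 0 ≤ κ) (hq : ∀ᵐ x ∂μ, (q x)⁻¹.toReal * p x ≤ κ) {h : ℤ → X → ℝ≥0∞}
    (hm : seqLebModular p q μ h ≤ 1) : ∑' k, modular p μ (h k) ≤ 2 ^ κ := by
  have h2top : (2 : ℝ≥0∞) ^ κ ≠ ∞ := ENNReal.rpow_ne_top_of_nonneg hκ ENNReal.ofNat_ne_top
  have h20 : (2 : ℝ≥0∞) ^ κ ≠ 0 := (ENNReal.rpow_pos (by norm_num) (by norm_num)).ne'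
  have h21 : (1 : ℝ≥0∞) ≤ 2 ^ κ := by
    simpa using ENNReal.rpow_le_rpow ENNReal.one_lt_two.le hκ
  have hone : ∀ x, 1 ≤ (q x)⁻¹.toReal * p x := by
    intro x
    have hqt : q x ≠ ∞ := ne_top_of_le_ne_top ENNReal.ofReal_ne_top (hqp x)
    have hqr : 0 < (q x).toReal := ENNReal.toReal_pos (hq0 x).ne' hqt
    rw [ENNReal.toReal_inv, inv_mul_eq_div, one_le_div hqr]
    exact ENNReal.toReal_le_of_le_ofReal (hp x).le (hqp x)
  have key : ∀ k, modular p μ (h k) ≤ 2 ^ κ * sInf {l : ℝ≥0∞ | 0 < l ∧ l < ∞ ∧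
      modular p μ (fun x => h k x / l ^ ((q x)⁻¹).toReal) ≤ 1} := by
    intro k
    set I := sInf {l : ℝ≥0∞ | 0 < l ∧ l < ∞ ∧
      modular p μ (fun x => h k x / l ^ ((q x)⁻¹).toReal) ≤ 1} with hI
    have hlt : I < 2 := ((ENNReal.le_tsum k).trans hm).trans_lt ENNReal.one_lt_two
    rw [mul_comm, ← ENNReal.div_le_iff h20 h2top]
    refine le_of_forall_gt_imp_ge_of_dense fun m hIm => ?_
    obtain ⟨l, ⟨hl0, hltop, hl⟩, hlm⟩ := sInf_lt_iff.1 (lt_min hIm hlt)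
    have hl2 : l ≤ 2 := (hlm.trans_le (min_le_right _ _)).le
    rw [ENNReal.div_le_iff h20 h2top]
    calc modular p μ (h k) ≤ 2 ^ κ * l := by
          refine modular_le_of_weight hp hl0 hltop (ENNReal.mul_ne_top h2top hltop.ne) ?_ hl
          filter_upwards [hq] with x hx
          -- For `l ≤ 1` the condition `p/q ≥ 1`, which comes from `q ≤ p`, gives `l^{p/q} ≤ l`. For
          -- `1 ≤ l ≤ 2` the factor `2^κ` suffices.
          rcases le_total l 1 with hl1 | hl1
          · calc l ^ ((q x)⁻¹.toReal * p x) ≤ l ^ (1 : ℝ) :=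
                  ENNReal.rpow_le_rpow_of_exponent_ge hl1 (hone x)
              _ = 1 * l := by rw [ENNReal.rpow_one, one_mul]
              _ ≤ 2 ^ κ * l := by gcongr
          · calc l ^ ((q x)⁻¹.toReal * p x) ≤ l ^ κ :=
                  ENNReal.rpow_le_rpow_of_exponent_le hl1 hx
              _ ≤ 2 ^ κ := ENNReal.rpow_le_rpow hl2 hκ
              _ = 2 ^ κ * 1 := (mul_one _).symm
              _ ≤ 2 ^ κ * l := by gcongr
      _ = l * 2 ^ κ := mul_comm _ _
      _ ≤ m * 2 ^ κ := by gcongr; exact (hlm.trans_le (min_le_left _ _)).le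
  calc ∑' k, modular p μ (h k) ≤ ∑' k, 2 ^ κ * sInf {l : ℝ≥0∞ | 0 < l ∧ l < ∞ ∧
          modular p μ (fun x => h k x / l ^ ((q x)⁻¹).toReal) ≤ 1} := ENNReal.tsum_le_tsum key
    _ = 2 ^ κ * seqLebModular p q μ h := ENNReal.tsum_mul_left
    _ ≤ 2 ^ κ * 1 := by gcongr
    _ = 2 ^ κ := mul_one _

/-- Geometrically weighted suprema of a bounded sequence in `L^p` are in `L^p`. -/
theorem modular_iSup_geometric_le {p : X → ℝ} (hpm : Measurable p) (hp : ∀ x, 0 < p x) {a : ℝ}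
    (hpa : ∀ᵐ x ∂μ, a ≤ p x) {ρ W : ℝ≥0∞} (hρ : ρ ≤ 1) {h : ℕ → X → ℝ≥0∞}
    (hh : ∀ k, Measurable (h k)) (hW : ∀ k, modular p μ (h k) ≤ W) :
    modular p μ (fun x => ⨆ k, ρ ^ k * h k x) ≤ (1 - ρ ^ a)⁻¹ * W := by
  refine (modular_iSup_le hpm hp fun k => (hh k).const_mul _).trans ?_
  rw [← ENNReal.tsum_geometric, ← ENNReal.tsum_mul_right]
  refine ENNReal.tsum_le_tsum fun k => ?_
  have hk : ρ ^ k ≤ 1 := pow_le_one₀ zero_le hρ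
  -- As `ρ^k ≤ 1` and `p ≥ a`, the `k`-th weight contributes at most `(ρ^a)^k`, which sums to `(1 -
  -- ρ^a)⁻¹`.
  have hka : (ρ ^ a) ^ k = (ρ ^ k) ^ a := by
    rw [← ENNReal.rpow_natCast, ← ENNReal.rpow_natCast, ← ENNReal.rpow_mul, ← ENNReal.rpow_mul,
      mul_comm]
  calc modular p μ (fun x => ρ ^ k * h k x) ≤ ∫⁻ x, (ρ ^ a) ^ k * h k x ^ p x ∂μ := by
        refine lintegral_mono_ae ?_
        filter_upwards [hpa] with x hx
        rw [ENNReal.mul_rpow_of_nonneg _ _ (hp x).le, hka]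
        exact mul_le_mul_left (ENNReal.rpow_le_rpow_of_exponent_ge hk hx) _
    _ = (ρ ^ a) ^ k * modular p μ (h k) := lintegral_const_mul _ ((hh k).pow hpm)
    _ ≤ _ := by gcongr; exact hW k

end Modular

/-! ### From gradients to embeddings. -/

section Embedding

variable {X : Type*} [MetricSpace X] [MeasurableSpace X] {μ : Measure X}

/-- A criterion for Sobolev embeddings: scaled down by any `L` above the seminorm, the function
has a gradient with bounded modular controlling its differences at distances less than `1`. -/
theorem continuouslyEmbeds_of_gradient {Q p s : X → ℝ} (hQ : IsBddLogExponent Q μ)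
    (hreg : LowerAhlforsRegular Q μ) (hp : IsBddLogExponent p μ) (hs : IsBddLogExponent s μ)
    (hgap : MuchLess (fun x => s x * p x) Q μ) {E : Set (X → EReal)}
    (hom : (X → EReal) → ℝ≥0∞) {A : ℝ≥0∞} (hA : A ≠ ∞)
    (hE : ∀ u ∈ E, (∀ᵐ x ∂μ, u x ≠ ⊥ ∧ u x ≠ ⊤) ∧ u ∈ lpSpace p μ ∧ hom u < ∞)
    (hgrad : ∀ u ∈ E, ∀ L : ℝ≥0∞, hom u < L → L < ∞ → ∃ G : X → ℝ≥0∞, Measurable G ∧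
      modular p μ G ≤ A ∧ ∃ N : Set X, μ N = 0 ∧ ∀ x y, x ∉ N → y ∉ N → x ≠ y → dist x y < 1 →
        (u x - u y).abs ≤
          L * (ENNReal.ofReal (dist x y ^ s x) * G x + ENNReal.ofReal (dist x y ^ s y) * G y)) :
    ContinuouslyEmbeds E (fun u => lpNorm p μ u + hom u)
      (lpSpace (fun x => Q x * p x / (Q x - s x * p x)) μ)
      (lpNorm (fun x => Q x * p x / (Q x - s x * p x)) μ) := by
  obtain ⟨T, a, M, ε, hT, hB⟩ := exists_exponentBounds hQ hp hs hgap
  set γ : X → ℝ := fun x => Q x * p x / (Q x - s x * p x) with hγ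
  have ha := hB.a_pos
  have hγa : ∀ᵐ x ∂μ, a ≤ γ x := by
    filter_upwards [hT] with x hx using (hB.le_p x hx).trans (hB.sobolev_exponent_mem hx).1
  have hγM : ∀ᵐ x ∂μ, γ x ≤ M * M / ε := by
    filter_upwards [hT] with x hx using (hB.sobolev_exponent_mem hx).2
  have hpa : ∀ᵐ x ∂μ, a ≤ p x := by filter_upwards [hT] with x hx using hB.le_p x hx
  have hA1 : max 1 A ≠ ∞ := (max_lt ENNReal.one_lt_top hA.lt_top).ne
  obtain ⟨K, -, hK⟩ := exists_ae_rpow_le hQ hreg hp hs hgap (A := (max 1 A).toReal)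
    ENNReal.toReal_nonneg
  rw [ENNReal.ofReal_toReal hA1] at hK
  set B : ℝ≥0∞ := max 1 (ENNReal.ofReal K * (1 + A)) with hBdef
  have hB1 : 1 ≤ B := le_max_left _ _
  have hBtop : B ≠ ∞ := (max_lt ENNReal.one_lt_top (ENNReal.mul_lt_top ENNReal.ofReal_lt_top
    (ENNReal.add_lt_top.2 ⟨ENNReal.one_lt_top, hA.lt_top⟩))).ne
  -- The pointwise inequality is integrated for `u / L`; `B` depends on neither `u` nor `L`, so the
  -- homogeneity is recovered by letting `L` decrease to the quasi-norm.
  have main : ∀ u ∈ E, ∀ L : ℝ≥0∞, lpNorm p μ u + hom u < L → L < ∞ →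
      modular γ μ (fun x => (u x).abs / L) ≤ B := by
    intro u hu L hL hLtop
    obtain ⟨hfin, ⟨humeas, -⟩, -⟩ := hE u hu
    have hL0 : L ≠ 0 := (bot_le.trans_lt hL).ne'
    obtain ⟨G, hG, hGA, N, hN, hNgrad⟩ := hgrad u hu L (le_add_self.trans_lt hL) hLtop
    have hlp : modular p μ (fun x => (u x).abs / L) ≤ 1 :=
      modular_div_le_one_of_lebNorm_lt hp.pos (le_self_add.trans_lt hL)
    set l := L.toReal with hl
    have hl0 : 0 < l := ENNReal.toReal_pos hL0 hLtop.ne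
    have hlL : ENNReal.ofReal l = L := ENNReal.ofReal_toReal hLtop.ne
    -- `EReal.toReal` sends infinite values to `0`; this affects only a null set, added to the
    -- exceptional set below.
    set V : X → ℝ := fun x => (u x).toReal / l with hV
    have habs : ∀ r : ℝ, ENNReal.ofReal |r / l| = (r : EReal).abs / L := by
      intro r
      rw [abs_div, abs_of_pos hl0, ENNReal.ofReal_div_of_pos hl0, hlL, EReal.abs_def]
    have hVu : ∀ x, u x ≠ ⊥ ∧ u x ≠ ⊤ → ENNReal.ofReal |V x| = (u x).abs / L := by
      intro x hx
      rw [hV]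
      simp only
      rw [habs, EReal.coe_toReal hx.2 hx.1]
    have hVp : modular p μ (fun x => ENNReal.ofReal |V x|) ≤ 1 := by
      refine le_trans (lintegral_mono_ae ?_) hlp
      filter_upwards [hfin] with x hx
      rw [hVu x hx]
    have hres := hK V G (humeas.ereal_toReal.div_const l) hG (hVp.trans (le_max_left _ _))
      (hGA.trans (le_max_right _ _)) (N ∪ {x | ¬(u x ≠ ⊥ ∧ u x ≠ ⊤)})
      (measure_union_null hN hfin) ?_
    · calc modular γ μ (fun x => (u x).abs / L)
          ≤ ∫⁻ x, ENNReal.ofReal K * (ENNReal.ofReal |V x| ^ p x + G x ^ p x) ∂μ := by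
            refine lintegral_mono_ae ?_
            filter_upwards [hres, hfin] with x h1 h2
            rw [← hVu x h2]
            exact h1
        _ = ENNReal.ofReal K * (modular p μ (fun x => ENNReal.ofReal |V x|) + modular p μ G) := by
            rw [lintegral_const_mul' _ _ ENNReal.ofReal_ne_top,
              lintegral_add_right _ (hG.pow hp.measurable)]
            rfl
        _ ≤ ENNReal.ofReal K * (1 + A) := by gcongr
        _ ≤ B := le_max_right _ _
    · intro x y hx hy hne hd
      simp only [mem_union, mem_ofPred_eq, not_or, not_not] at hx hy
      have h1 := hNgrad x y hx.1 hy.1 hne hd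
      have e : V x - V y = ((u x).toReal - (u y).toReal) / l := by rw [hV]; ring
      rw [e, habs, EReal.coe_sub, EReal.coe_toReal hx.2.2 hx.2.1, EReal.coe_toReal hy.2.2 hy.2.1]
      exact ENNReal.div_le_of_le_mul' h1
  have hfinite : ∀ u ∈ E, lpNorm p μ u + hom u < ∞ := fun u hu =>
    ENNReal.add_lt_top.2 ⟨lebNorm_lt_top ha hpa (hE u hu).2.1.2, (hE u hu).2.2⟩
  refine ⟨fun u hu => ⟨(hE u hu).2.1.1, ?_⟩, B ^ (1 / a),
    ENNReal.rpow_lt_top_of_nonneg (by positivity) hBtop, fun u hu => ?_⟩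
  -- Membership asks for a finite modular of `u`, not of `u / L`; undoing the scaling costs a finite
  -- factor because `γ` is essentially bounded.
  · obtain ⟨L, hL, hLtop⟩ := exists_between (hfinite u hu)
    have hL0 : L ≠ 0 := (bot_le.trans_lt hL).ne'
    have hΓ : 0 ≤ M * M / ε := div_nonneg (mul_self_nonneg M) hB.ε_pos.le
    have hW : max 1 L ^ (M * M / ε) ≠ ∞ :=
      ENNReal.rpow_ne_top_of_nonneg hΓ (max_lt ENNReal.one_lt_top hLtop).ne
    calc modular γ μ (fun x => (u x).abs)
        ≤ ∫⁻ x, max 1 L ^ (M * M / ε) * ((u x).abs / L) ^ γ x ∂μ := by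
          refine lintegral_mono_ae ?_
          filter_upwards [hγa, hγM] with x h1 h2
          have h0 : 0 ≤ γ x := ha.le.trans h1
          calc (u x).abs ^ γ x = (L * ((u x).abs / L)) ^ γ x := by
                rw [ENNReal.mul_div_cancel hL0 hLtop.ne]
            _ = L ^ γ x * ((u x).abs / L) ^ γ x := ENNReal.mul_rpow_of_nonneg _ _ h0
            _ ≤ _ := by
                gcongr
                exact (ENNReal.rpow_le_rpow (le_max_right 1 L) h0).trans
                  (ENNReal.rpow_le_rpow_of_exponent_le (le_max_left _ _) h2)
      _ = max 1 L ^ (M * M / ε) * modular γ μ (fun x => (u x).abs / L) :=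
          lintegral_const_mul' _ _ hW
      _ ≤ max 1 L ^ (M * M / ε) * B := by gcongr; exact main u hu L hL hLtop
      _ < ∞ := ENNReal.mul_lt_top hW.lt_top hBtop.lt_top
  · have hC0 : B ^ (1 / a) ≠ 0 := (ENNReal.rpow_pos (zero_lt_one.trans_le hB1) hBtop).ne'
    have hCtop : B ^ (1 / a) ≠ ∞ := ENNReal.rpow_ne_top_of_nonneg (by positivity) hBtop
    rw [mul_comm, ← ENNReal.div_le_iff hC0 hCtop]
    refine le_of_forall_gt_imp_ge_of_dense fun L hL => ?_
    rcases eq_or_ne L ∞ with rfl | hLtop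
    · exact le_top
    have hL0 : L ≠ 0 := (bot_le.trans_lt hL).ne'
    rw [ENNReal.div_le_iff hC0 hCtop]
    refine sInf_le ⟨pos_iff_ne_zero.2 (mul_ne_zero hL0 hC0),
      ENNReal.mul_lt_top hLtop.lt_top hCtop.lt_top, ?_⟩
    have := modular_div_rpow_le_one ha hγa hB1 hBtop (main u hu L hL hLtop.lt_top)
    refine le_trans (le_of_eq ?_) this
    congr 1
    ext x
    simp only [div_eq_mul_inv]
    rw [ENNReal.mul_inv (Or.inl hL0) (Or.inl hLtop), mul_assoc]

/-- Distances below `1` involve only the components `g_k` with `k ≥ 0`, for which the weights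
`2^{-εk}` do not exceed `1`. -/
theorem exists_nat_dyadic_scale {d : ℝ} (h0 : 0 < d) (h1 : d < 1) :
    ∃ k : ℕ, (2 : ℝ) ^ (-(k : ℤ) - 1) ≤ d ∧ d < (2 : ℝ) ^ (-(k : ℤ)) := by
  obtain ⟨n, hn1, hn2⟩ := exists_mem_Ico_zpow h0 (one_lt_two : (1 : ℝ) < 2)
  have hn : n < 0 := by
    by_contra! hcon
    have := one_le_zpow₀ (one_lt_two : (1 : ℝ) < 2).le hcon
    linarith
  obtain ⟨k, hk⟩ := Int.eq_ofNat_of_zero_le (show 0 ≤ -n - 1 by lia)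
  refine ⟨k, ?_, ?_⟩
  · rwa [show -(k : ℤ) - 1 = n by lia]
  · rwa [show -(k : ℤ) = n + 1 by lia]

/-- Passing from a vector `s`-gradient to a scalar gradient of order `t ≤ s - ε`. -/
theorem exists_null_of_vectorGradients {s t : X → ℝ} {ε : ℝ}
    (hts : ∀ᵐ x ∂μ, ε ≤ s x - t x) (hε : 0 ≤ ε) {u : X → EReal} {g : ℤ → X → ℝ≥0∞}
    (hg : g ∈ vectorGradients s μ u) {l L : ℝ≥0∞} (hl0 : l ≠ 0) (hltop : l ≠ ∞) (hlL : l ≤ L)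
    {G : X → ℝ≥0∞}
    (hG : ∀ (k : ℕ) x, ENNReal.ofReal (2 ^ (-ε)) ^ k * (g k x / l) ≤ G x) :
    ∃ N : Set X, μ N = 0 ∧ ∀ x y, x ∉ N → y ∉ N → x ≠ y → dist x y < 1 →
      (u x - u y).abs ≤
        L * (ENNReal.ofReal (dist x y ^ t x) * G x + ENNReal.ofReal (dist x y ^ t y) * G y) := by
  obtain ⟨-, N, hN, hgrad⟩ := hg
  refine ⟨N ∪ {x | ¬ ε ≤ s x - t x}, measure_union_null hN hts, fun x y hx hy hne hd1 => ?_⟩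
  simp only [mem_union, mem_ofPred_eq, not_or, not_not] at hx hy
  have hd0 : 0 < dist x y := dist_pos.2 hne
  obtain ⟨k, hk1, hk2⟩ := exists_nat_dyadic_scale hd0 hd1
  have key : ∀ z, ε ≤ s z - t z → ENNReal.ofReal (dist x y ^ s z) * g k z ≤
      L * (ENNReal.ofReal (dist x y ^ t z) * G z) := by
    intro z hz
    -- The surplus order `s - t ≥ ε` at distance below `2^{-k}` gains the factor `2^{-εk}`; with `ε
    -- = 0` nothing is gained and `t = s` is allowed.
    have hpow : dist x y ^ s z ≤ dist x y ^ t z * ((2 : ℝ) ^ (-ε)) ^ k := by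
      calc dist x y ^ s z = dist x y ^ t z * dist x y ^ (s z - t z) := by
            rw [← Real.rpow_add hd0]; ring_nf
        _ ≤ dist x y ^ t z * dist x y ^ ε := by
            gcongr ?_ * ?_
            exact Real.rpow_le_rpow_of_exponent_ge hd0 hd1.le hz
        _ ≤ dist x y ^ t z * ((2 : ℝ) ^ (-(k : ℤ))) ^ ε := by gcongr
        _ = _ := by
            rw [← Real.rpow_natCast, ← Real.rpow_mul (by norm_num), ← Real.rpow_intCast,
              ← Real.rpow_mul (by norm_num)]
            push_cast
            ring_nf
    calc ENNReal.ofReal (dist x y ^ s z) * g k z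
        ≤ ENNReal.ofReal (dist x y ^ t z * ((2 : ℝ) ^ (-ε)) ^ k) * g k z := by gcongr
      _ = ENNReal.ofReal (dist x y ^ t z) *
            (ENNReal.ofReal (2 ^ (-ε)) ^ k * (l * (g k z / l))) := by
          rw [ENNReal.ofReal_mul (by positivity), ENNReal.ofReal_pow (by positivity),
            ENNReal.mul_div_cancel hl0 hltop, mul_assoc]
      _ = l * (ENNReal.ofReal (dist x y ^ t z) *
            (ENNReal.ofReal (2 ^ (-ε)) ^ k * (g k z / l))) := by ring
      _ ≤ L * (ENNReal.ofReal (dist x y ^ t z) * G z) := by gcongr; exact hG k z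
  rw [mul_add]
  exact (hgrad k x y hx.1 hy.1 hk1 hk2).trans (add_le_add (key x hx.2) (key y hy.2))

/-- The scalar gradient `sup_k g_k / l` is pointwise below the `ℓ^{q(x)}` quasi-norm of the sequence
for every `q`, so its modular is at most `1`. -/
theorem tlSpace_embeds {Q p s : X → ℝ} (hQ : IsBddLogExponent Q μ)
    (hreg : LowerAhlforsRegular Q μ) (hp : IsBddLogExponent p μ) (hs : IsBddLogExponent s μ)
    (hgap : MuchLess (fun x => s x * p x) Q μ) {q : X → ℝ≥0∞} (hq : IsExponent q μ) :
    ContinuouslyEmbeds (TLSpace s p q μ) (tlNorm s p q μ)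
      (lpSpace (fun x => Q x * p x / (Q x - s x * p x)) μ)
      (lpNorm (fun x => Q x * p x / (Q x - s x * p x)) μ) := by
  refine continuouslyEmbeds_of_gradient hQ hreg hp hs hgap (homTLNorm s p q μ)
    (A := 1) ENNReal.one_ne_top (fun u hu => ⟨hu.1.2.1, hu.2, hu.1.2.2⟩) fun u _ L hL _ => ?_
  simp only [homTLNorm, iInf_lt_iff] at hL
  obtain ⟨g, hg, hgL⟩ := hL
  obtain ⟨l, ⟨hl0, hltop, hl⟩, hlL⟩ := sInf_lt_iff.1 hgL
  refine ⟨fun x => ⨆ k : ℕ, g k x / l, .iSup fun k => (hg.1 k).div_const l, ?_, ?_⟩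
  · refine le_trans (lintegral_mono fun x => ?_) hl
    refine ENNReal.rpow_le_rpow (iSup_le fun k => ?_) (hp.pos x).le
    exact ENNReal.div_le_div_right (le_seqNorm (hq.pos x) g k) _
  · refine exists_null_of_vectorGradients (ε := 0) (by simp) le_rfl hg hl0.ne' hltop.ne hlL.le
      fun k x => ?_
    simpa using le_iSup (fun k : ℕ => g k x / l) k

/-- The same supremum works: its modular is at most the sum of the modulars of the `g_k / l`, which
`q ≤ p` makes finite. -/
theorem besovSpace_embeds_of_le {Q p s : X → ℝ} (hQ : IsBddLogExponent Q μ)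
    (hreg : LowerAhlforsRegular Q μ) (hp : IsBddLogExponent p μ) (hs : IsBddLogExponent s μ)
    (hgap : MuchLess (fun x => s x * p x) Q μ) {q : X → ℝ≥0∞} (hq : IsExponent q μ)
    (hqp : ∀ x, q x ≤ ENNReal.ofReal (p x)) :
    ContinuouslyEmbeds (BesovSpace s p q μ) (besovNorm s p q μ)
      (lpSpace (fun x => Q x * p x / (Q x - s x * p x)) μ)
      (lpNorm (fun x => Q x * p x / (Q x - s x * p x)) μ) := by
  obtain ⟨a, M, -, hM⟩ := hp.exists_bounds
  obtain ⟨κ, hκ, hqκ⟩ := hq.exists_mul_le hp.pos (hM.mono fun x hx => hx.2)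
  refine continuouslyEmbeds_of_gradient hQ hreg hp hs hgap (homBesovNorm s p q μ)
    (A := 2 ^ κ) (ENNReal.rpow_ne_top_of_nonneg hκ ENNReal.ofNat_ne_top)
    (fun u hu => ⟨hu.1.2.1, hu.2, hu.1.2.2⟩) fun u _ L hL _ => ?_
  simp only [homBesovNorm, iInf_lt_iff] at hL
  obtain ⟨g, hg, hgL⟩ := hL
  obtain ⟨l, ⟨hl0, hltop, hl⟩, hlL⟩ := sInf_lt_iff.1 hgL
  have hmeas : ∀ k : ℤ, Measurable fun x => g k x / l := fun k => (hg.1 k).div_const l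
  refine ⟨fun x => ⨆ k : ℤ, g k x / l, .iSup hmeas, ?_, ?_⟩
  · exact (modular_iSup_le hp.measurable hp.pos hmeas).trans
      (tsum_modular_le_of_seqLebModular_le_one hp.pos hq.pos hqp hκ hqκ hl)
  · refine exists_null_of_vectorGradients (ε := 0) (by simp) le_rfl hg hl0.ne' hltop.ne hlL.le
      fun k x => ?_
    simpa using le_iSup (fun k : ℤ => g k x / l) k

/-- For general `q` the modulars of the `g_k / l` are only uniformly bounded. Lowering the order
from `s` to `t` supplies weights `ρ^k` that make the supremum's modular summable. -/
theorem besovSpace_embeds_of_muchLess {Q p s t : X → ℝ} (hQ : IsBddLogExponent Q μ)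
    (hreg : LowerAhlforsRegular Q μ) (hp : IsBddLogExponent p μ) (ht : IsBddLogExponent t μ)
    (hgap : MuchLess (fun x => s x * p x) Q μ) (hts : MuchLess t s μ) {q : X → ℝ≥0∞}
    (hq : IsExponent q μ) :
    ContinuouslyEmbeds (BesovSpace s p q μ) (besovNorm s p q μ)
      (lpSpace (fun x => Q x * p x / (Q x - t x * p x)) μ)
      (lpNorm (fun x => Q x * p x / (Q x - t x * p x)) μ) := by
  obtain ⟨a, M, ha, hM⟩ := hp.exists_bounds
  obtain ⟨ε, hε, hεts⟩ := hts.exists_gap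
  obtain ⟨η, hη, hηgap⟩ := hgap.exists_gap
  -- `t ≤ s` almost everywhere, so the gap for `sp` is inherited by `tp`.
  have hgap' : MuchLess (fun x => t x * p x) Q μ := by
    refine lt_of_lt_of_le (EReal.coe_pos.2 hη) (le_essInf_of_ae_le _ ?_)
    filter_upwards [hεts, hηgap] with x h1 h2
    have := hp.pos x
    exact EReal.coe_le_coe_iff.2 (by nlinarith)
  obtain ⟨κ, hκ, hqκ⟩ := hq.exists_mul_le hp.pos (hM.mono fun x hx => hx.2)
  set ρ : ℝ≥0∞ := ENNReal.ofReal (2 ^ (-ε)) with hρ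
  have hρ1 : ρ < 1 := by
    rw [hρ, ENNReal.ofReal_lt_one]
    exact Real.rpow_lt_one_of_one_lt_of_neg one_lt_two (by linarith)
  have hA : (1 - ρ ^ a)⁻¹ * 2 ^ κ ≠ ∞ := by
    refine ENNReal.mul_ne_top (ENNReal.inv_ne_top.2 ?_)
      (ENNReal.rpow_ne_top_of_nonneg hκ ENNReal.ofNat_ne_top)
    exact (tsub_pos_of_lt (ENNReal.rpow_lt_one hρ1 ha)).ne'
  refine continuouslyEmbeds_of_gradient hQ hreg hp ht hgap' (homBesovNorm s p q μ)
    hA (fun u hu => ⟨hu.1.2.1, hu.2, hu.1.2.2⟩) fun u _ L hL _ => ?_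
  simp only [homBesovNorm, iInf_lt_iff] at hL
  obtain ⟨g, hg, hgL⟩ := hL
  obtain ⟨l, ⟨hl0, hltop, hl⟩, hlL⟩ := sInf_lt_iff.1 hgL
  have hmeas : ∀ k : ℕ, Measurable fun x => g k x / l := fun k => (hg.1 k).div_const l
  refine ⟨fun x => ⨆ k : ℕ, ρ ^ k * (g k x / l), .iSup fun k => (hmeas k).const_mul _, ?_, ?_⟩
  · exact modular_iSup_geometric_le hp.measurable hp.pos (hM.mono fun x hx => hx.1) hρ1.le hmeas
      fun k => modular_le_of_seqLebModular_le_one hp.pos hκ hqκ hl k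
  · exact exists_null_of_vectorGradients hεts hε.le hg hl0.ne' hltop.ne hlL.le
      fun k x => le_iSup (fun k : ℕ => ρ ^ k * (g k x / l)) k

end Embedding

end VarHajlasz

theorem mainTheorem6 {X : Type*} [MetricSpace X] [MeasurableSpace X] [BorelSpace X]
    (μ : Measure X) (hμ : VarHajlasz.IsMetricMeasureSpace μ)
    (hX : VarHajlasz.GeometricallyDoubling X)
    (hδ : ∃ δ : ℝ, 0 < δ ∧ (⨆ x : X, μ (Metric.ball x δ)) < ∞)
    (Q p s : X → ℝ)
    (hQ : VarHajlasz.IsBddLogExponent Q μ)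
    (hreg : VarHajlasz.LowerAhlforsRegular Q μ)
    (hp : VarHajlasz.IsBddLogExponent p μ)
    (hs : VarHajlasz.IsBddLogExponent s μ)
    (hspQ : VarHajlasz.MuchLess (fun x => s x * p x) Q μ) :
    (∀ q : X → ℝ≥0∞, VarHajlasz.IsExponent q μ →
      VarHajlasz.ContinuouslyEmbeds
        (VarHajlasz.TLSpace s p q μ) (VarHajlasz.tlNorm s p q μ)
        (VarHajlasz.lpSpace (fun x => Q x * p x / (Q x - s x * p x)) μ)
        (VarHajlasz.lpNorm (fun x => Q x * p x / (Q x - s x * p x)) μ)) ∧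
    (∀ q : X → ℝ≥0∞, VarHajlasz.IsExponent q μ → (∀ x, q x ≤ ENNReal.ofReal (p x)) →
      VarHajlasz.ContinuouslyEmbeds
        (VarHajlasz.BesovSpace s p q μ) (VarHajlasz.besovNorm s p q μ)
        (VarHajlasz.lpSpace (fun x => Q x * p x / (Q x - s x * p x)) μ)
        (VarHajlasz.lpNorm (fun x => Q x * p x / (Q x - s x * p x)) μ)) ∧
    (∀ (q : X → ℝ≥0∞) (t : X → ℝ), VarHajlasz.IsExponent q μ →
      VarHajlasz.IsBddLogExponent t μ → VarHajlasz.MuchLess t s μ →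
      VarHajlasz.ContinuouslyEmbeds
        (VarHajlasz.BesovSpace s p q μ) (VarHajlasz.besovNorm s p q μ)
        (VarHajlasz.lpSpace (fun x => Q x * p x / (Q x - t x * p x)) μ)
        (VarHajlasz.lpNorm (fun x => Q x * p x / (Q x - t x * p x)) μ)) := by
  exact ⟨fun _ hq => VarHajlasz.tlSpace_embeds hQ hreg hp hs hspQ hq,
    fun _ hq hqp => VarHajlasz.besovSpace_embeds_of_le hQ hreg hp hs hspQ hq hqp,
    fun _ _ hq ht hts => VarHajlasz.besovSpace_embeds_of_muchLess hQ hreg hp ht hspQ hts hq⟩
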